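/- For a Borel probability measure $P$ on $\mathbb{R}^2$ and a nonempty finite set $\alpha\subset\mathbb{R}^2$ put $V(P;\alpha)=\int\min_{a\in\alpha}\|x-a\|^2\,dP(x)$, and for $n\ge 1$ let $V_n(P)=\inf\{V(P;\alpha):1\le\operatorname{card}\alpha\le n\}$ be the $n$-th quantization error. An optimal set of $n$-means is a set $\alpha$ with $1\le\operatorname{card}\alpha\le n$ and $V(P;\alpha)=V_n(P)$. For $a\in\alpha$, the Voronoi region $M(a|\alpha)$ is the set of all points that are closest to $a$ among all elements of $\alpha$. Let $m\ge 3$, and let $A_j=\bigl(\cos\frac{2\pi(j-1)}{m},\sin\frac{2\pi(j-1)}{m}\bigr)$ be the vertices of the regular $m$-gon inscribed in the unit circle, where indices are read modulo $m$. Let $M_j(t)=tA_{j+1}+(1-t)A_j$, $0\le t\le 1$, parametrize the side $A_jA_{j+1}$, let $\ell=2\sin\frac{\pi}{m}$ be the side length and $L$ the boundary of the polygon, and let $P$ be the uniform distribution (normalized arc length) on $L$. Let $k\ge 2$, $n=mk$, and $$r=\frac{4\sin\frac{\pi}{m}}{2(k-1)\sqrt{3\cos^2\frac{\pi}{m}+1}+4}.$$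 Let $a_1=\bigl(1-\tfrac12 r\sin\tfrac{\pi}{m},\,0\bigr)$, and for $2\le j\le m$ let $$a_j=\Bigl(\tfrac14\cos\tfrac{2\pi(j-1)}{m}\bigl(r(\cos\tfrac{2\pi}{m}-1)\csc\tfrac{\pi}{m}+4\bigr),\ \sin\tfrac{2\pi(j-1)}{m}\bigl(\tfrac14 r(\cos\tfrac{2\pi}{m}-1)\csc\tfrac{\pi}{m}+1\bigr)\Bigr).$$ Then: 1. There is exactly one optimal set of $n$-means for $P$, namely $$\alpha_n=\{a_j:1\le j\le m\}\cup\bigcup_{j=1}^m\Bigl\{M_j\Bigl(\tfrac r\ell+\tfrac{2i-1}{2(k-1)}\bigl(1-\tfrac{2r}{\ell}\bigr)\Bigr):1\le i\le k-1\Bigr\},$$ and it has exactly $mk$ elements. 2. $0<r\le\ell/2$, and for every $1\le j\le m$ the point $a_j$ lies in the interior of the angle of the polygon at $A_j$, and the boundary of its Voronoi region $M(a_j|\alpha_n)$ meets $L$ in exactly two points, one on each of the two sides adjacent to $A_j$ and both at distance $r$ from $A_j$, namely $M_{j-1}(1-\frac r\ell)$ and $M_j(\frac r\ell)$. 3. The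 $n$-th quantization error is $$V_n(P)=\frac{2\sin^2\frac{\pi}{m}\,\bigl(3\cos\frac{2\pi}{m}+5\bigr)}{3\Bigl(k\sqrt{6\cos\frac{2\pi}{m}+10}-\sqrt{6\cos\frac{2\pi}{m}+10}+4\Bigr)^2}.$$ -/

import Mathlib

open MeasureTheory

/-- The Euclidean plane. -/
abbrev Plane : Type := EuclideanSpace ℝ (Fin 2)

/-- The distortion error `V(P; α) = ∫ min_{a ∈ α} ‖x - a‖² dP(x)` of a finite set `α`.
(For a nonempty finite set the infimum is the minimum; the empty set is excluded wherever
this is used.) -/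
noncomputable def distortion {d : ℕ} (P : Measure (EuclideanSpace ℝ (Fin d)))
    (α : Finset (EuclideanSpace ℝ (Fin d))) : ℝ :=
  ∫ x, (⨅ a : α, ‖x - a‖ ^ 2) ∂P

/-- The `n`-th quantization error `V_n(P) = inf {V(P; α) : 1 ≤ card α ≤ n}`. -/
noncomputable def quantizationError {d : ℕ} (P : Measure (EuclideanSpace ℝ (Fin d)))
    (n : ℕ) : ℝ :=
  sInf {v : ℝ | ∃ α : Finset (EuclideanSpace ℝ (Fin d)),
    1 ≤ α.card ∧ α.card ≤ n ∧ v = distortion P α}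

/-- An optimal set of `n`-means: a nonempty finite set with at most `n` points at which the
infimum defining `V_n(P)` is achieved. -/
def IsOptimalSetOfMeans {d : ℕ} (P : Measure (EuclideanSpace ℝ (Fin d))) (n : ℕ)
    (α : Finset (EuclideanSpace ℝ (Fin d))) : Prop :=
  1 ≤ α.card ∧ α.card ≤ n ∧ distortion P α = quantizationError P n

/-- The Voronoi region `M(a | α)`: the points which are closest to `a` among all elements
of `α`. -/
def voronoiRegion {d : ℕ} (α : Finset (EuclideanSpace ℝ (Fin d)))
    (a : EuclideanSpace ℝ (Fin d)) : Set (EuclideanSpace ℝ (Fin d)) :=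
  {x | ∀ b ∈ α, dist x a ≤ dist x b}

/-- The vertices `A_j` (`1 ≤ j ≤ m`) of the regular `m`-gon inscribed in the unit circle. The
formula is `m`-periodic in `j`, so that `A_{m+1} = A_1` and `A_0 = A_m`. -/
noncomputable def polyVertex (m j : ℕ) : Plane :=
  !₂[Real.cos (2 * Real.pi / m * ((j : ℝ) - 1)), Real.sin (2 * Real.pi / m * ((j : ℝ) - 1))]

/-- The parametrization `M_j(t) = t A_{j+1} + (1 - t) A_j` (`0 ≤ t ≤ 1`) of the side
`A_j A_{j+1}`. -/
noncomputable def polySide (m j : ℕ) (t : ℝ) : Plane :=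
  t • polyVertex m (j + 1) + (1 - t) • polyVertex m j

/-- The length `ℓ` of a side of the polygon, as the distance of its first two vertices. -/
noncomputable def polySideLength (m : ℕ) : ℝ :=
  dist (polyVertex m 1) (polyVertex m 2)

/-- The boundary `L` of the polygon, the union of its `m` sides. -/
def polyBoundary (m : ℕ) : Set Plane :=
  ⋃ j ∈ Finset.Icc 1 m, polySide m j '' Set.Icc (0 : ℝ) 1

/-- The uniform distribution on the boundary of the polygon: it has density `1 / (m ℓ)` with
respect to the arc length `ds`, and `ds = ℓ dt` on each side, so that `dP = (1 / m) dt` on the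
side parametrized by `M_j(t)`, `0 ≤ t ≤ 1`. -/
noncomputable def polyUniform (m : ℕ) : Measure Plane :=
  ∑ j ∈ Finset.Icc 1 m,
    ENNReal.ofReal (1 / (m * polySideLength m)) •
      (ENNReal.ofReal (polySideLength m) •
        (volume.restrict (Set.Icc (0 : ℝ) 1)).map (polySide m j))

/-- The interior of the angle of the polygon at the vertex `A_j` (`1 ≤ j ≤ m`), whose adjacent
vertices are `A_{j+1}` and `A_{j-1}`. -/
def polyAngleInterior (m j : ℕ) : Set Plane :=
  {x | ∃ u v : ℝ, 0 < u ∧ 0 < v ∧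
    x = polyVertex m j + u • (polyVertex m (j + 1) - polyVertex m j)
      + v • (polyVertex m (j - 1) - polyVertex m j)}

/-- The points `a_j` (`1 ≤ j ≤ m`) determined by a number `r`. -/
noncomputable def anglePoint (m : ℕ) (r : ℝ) (j : ℕ) : Plane :=
  if j = 1 then !₂[1 - 1 / 2 * r * Real.sin (Real.pi / m), 0]
  else
    !₂[1 / 4 * Real.cos (2 * Real.pi * ((j : ℝ) - 1) / m)
        * (r * (Real.cos (2 * Real.pi / m) - 1) * (1 / Real.sin (Real.pi / m)) + 4),
      Real.sin (2 * Real.pi * ((j : ℝ) - 1) / m)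
        * (1 / 4 * r * (Real.cos (2 * Real.pi / m) - 1) * (1 / Real.sin (Real.pi / m)) + 1)]

/-- The parameter `r/ℓ + (2i - 1)/(2(k - 1)) (1 - 2r/ℓ)` of the `i`-th of `k - 1` equally spaced
points on the part `r/ℓ ≤ t ≤ 1 - r/ℓ` of a side. -/
noncomputable def sideParam (m k : ℕ) (r : ℝ) (i : ℕ) : ℝ :=
  r / polySideLength m
    + (2 * (i : ℝ) - 1) / (2 * ((k : ℝ) - 1)) * (1 - 2 * r / polySideLength m)

open Classical in
/-- The set `{a_j : 1 ≤ j ≤ m} ∪ ⋃_j {M_j(t_i) : 1 ≤ i ≤ k - 1}`, where `t_i` are the parameters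
above. -/
noncomputable def polyMeans (m k : ℕ) (r : ℝ) : Finset Plane :=
  (Finset.Icc 1 m).image (anglePoint m r) ∪
    (Finset.Icc 1 m).biUnion fun j =>
      (Finset.Icc 1 (k - 1)).image fun i => polySide m j (sideParam m k r i)

/-!
The optimality of the configuration is a tangent line argument. Fix `ρ > 0`, and for a set `α` of
centres let `bump ρ α x` be the part of `ρ²` that is not used up by the squared distance from `x` to
`α`. The distortion is at least `ρ²` minus the mean of `bump ρ α` over the polygon, so that it
suffices to bound the mass that `n` centres capture, that is, the integral of `bump ρ α`. A single
centre captures at most `4/3 ρ³` of a line, with equality for a centre on the line, whose share is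
a segment of length `2 ρ`. In a corner it may capture more, namely `4/3 ρ³ / κ`, where
`κ² = (1 + 3 cos² (π / m)) / 4`: two segments of length `w / 2` at a vertex have second moment
`κ² w³ / 12` instead of `w³ / 12`, as `segCost_ge` shows.

The main step is that a corner pays only once: `n` centres near one vertex capture at most
`4/3 ρ³ (n - 1 + 1 / κ)` of the two sides there (`cornerMass_le`). Voronoi cells may consist of a
segment on either side without containing the vertex, and such a pair of segments can have a
smaller second moment than one segment of the same length. This happens only if the pair begins
so close to the vertex that its second moment also pays for all centres between it and the vertex
(`segCost_dichotomy`). In an induction, the centre farthest from the vertex is removed. This is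
possible because the part of a ray from the vertex closer to this centre than to the others is
up-closed (`exists_cell_on_ray`).

The radius `ρ` is chosen such that a side has length `2 r + 2 ρ (k - 1)`, where `r = ρ / κ`. Then
a disc of radius `ρ` meets only the two sides at some vertex (`Radii.exists_vertex`), each centre can
be attached to a vertex, and summing the corner inequality over the vertices shows that `m k`
centres have distortion at least `ρ² / 3` (`Radii.le_distortion`). The configuration of the theorem
attains this value (`Radii.distortion_polyMeans`).

If equality holds for `α`, then the equality case of the corner inequality puts a centre of `α`
into the optimal position at every vertex and the other centres on the sides. The masses captured
by the single centres now add up to no more than the total, so that the segments they capture do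
not overlap (`Radii.not_overlap`). Since every point of the polygon must also be within distance `ρ`
of a centre, the segments cover each side without gaps, and this determines the centres
(`Radii.side_mem_of_maximal`). The same two facts, applied to the optimal configuration, describe
the Voronoi regions of the corner centres along the polygon (`Radii.frontier_inter_polyBoundary`).
-/

/-! ### Truncated squared distances -/

section Bump

variable {E : Type*} [NormedAddCommGroup E]

/-- The function `x ↦ max (0, max_{a ∈ T} (ρ² - ‖x - a‖²))`: the amount by which the squared
distance from `x` to `T` falls short of `ρ²`. The supremum is taken in `ℝ≥0`, where it is `0` for
the empty set. -/
noncomputable def bump (ρ : ℝ) (T : Finset E) (x : E) : ℝ :=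
  ((T.sup fun a => (ρ ^ 2 - ‖x - a‖ ^ 2).toNNReal : NNReal) : ℝ)

lemma bump_nonneg (ρ : ℝ) (T : Finset E) (x : E) : 0 ≤ bump ρ T x := NNReal.coe_nonneg _

lemma le_bump (ρ : ℝ) {T : Finset E} {a : E} (ha : a ∈ T) (x : E) :
    ρ ^ 2 - ‖x - a‖ ^ 2 ≤ bump ρ T x := by
  have h := Finset.le_sup (f := fun a => (ρ ^ 2 - ‖x - a‖ ^ 2).toNNReal) ha
  exact (Real.le_coe_toNNReal _).trans (NNReal.coe_le_coe.2 h)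

lemma bump_le {ρ : ℝ} {T : Finset E} {x : E} {B : ℝ} (hB : 0 ≤ B)
    (h : ∀ a ∈ T, ρ ^ 2 - ‖x - a‖ ^ 2 ≤ B) : bump ρ T x ≤ B := by
  have : (T.sup fun a => (ρ ^ 2 - ‖x - a‖ ^ 2).toNNReal) ≤ B.toNNReal :=
    Finset.sup_le fun a ha => Real.toNNReal_le_toNNReal (h a ha)
  have h2 := NNReal.coe_le_coe.2 this
  rwa [Real.coe_toNNReal _ hB] at h2

lemma continuous_bump (ρ : ℝ) (T : Finset E) : Continuous (bump ρ T) := by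
  unfold bump
  refine NNReal.continuous_coe.comp (Continuous.finset_sup_apply fun a _ => ?_)
  exact continuous_real_toNNReal.comp (by fun_prop)

lemma bump_le_sq (ρ : ℝ) (T : Finset E) (x : E) : bump ρ T x ≤ ρ ^ 2 :=
  bump_le (sq_nonneg _) fun a _ => by nlinarith [sq_nonneg ‖x - a‖]

lemma bump_mono (ρ : ℝ) {S T : Finset E} (h : S ⊆ T) (x : E) : bump ρ S x ≤ bump ρ T x :=
  bump_le (bump_nonneg _ _ _) fun _ ha => le_bump ρ (h ha) x

lemma bump_empty (ρ : ℝ) (x : E) : bump ρ (∅ : Finset E) x = 0 :=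
  le_antisymm (bump_le le_rfl (by simp)) (bump_nonneg _ _ _)

lemma bump_eq_zero {ρ : ℝ} (hρ : 0 ≤ ρ) {T : Finset E} {x : E} (h : ∀ a ∈ T, ρ ≤ ‖x - a‖) :
    bump ρ T x = 0 :=
  le_antisymm (bump_le le_rfl fun a ha => by nlinarith [h a ha]) (bump_nonneg _ _ _)

lemma bump_pos {ρ : ℝ} {T : Finset E} {a : E} (ha : a ∈ T) {x : E} (h : ‖x - a‖ < ρ) :
    0 < bump ρ T x :=
  lt_of_lt_of_le (by nlinarith [norm_nonneg (x - a)]) (le_bump ρ ha x)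

end Bump

/-- A bounded order-connected subset of the line is an interval up to its two endpoints. -/
lemma exists_Ioo_subset_subset_Icc {L : ℝ} (hL : 0 ≤ L) {S : Set ℝ} (hS : S ⊆ Set.Icc 0 L)
    (hc : S.OrdConnected) :
    ∃ p q, 0 ≤ p ∧ p ≤ q ∧ q ≤ L ∧ Set.Ioo p q ⊆ S ∧ S ⊆ Set.Icc p q := by
  rcases S.eq_empty_or_nonempty with rfl | hne
  · exact ⟨0, 0, le_rfl, le_rfl, hL, by simp, by simp⟩
  have hb : BddBelow S := ⟨0, fun s hs => (hS hs).1⟩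
  have ha : BddAbove S := ⟨L, fun s hs => (hS hs).2⟩
  refine ⟨sInf S, sSup S, le_csInf hne fun s hs => (hS hs).1, csInf_le_csSup hne hb ha,
    csSup_le hne fun s hs => (hS hs).2, ?_, fun s hs => ⟨csInf_le hb hs, le_csSup ha hs⟩⟩
  rintro s ⟨h1, h2⟩
  obtain ⟨x, hx, hx2⟩ := exists_lt_of_csInf_lt hne h1
  obtain ⟨y, hy, hy2⟩ := exists_lt_of_lt_csSup hne h2
  exact hc.out hx hy ⟨hx2.le, hy2.le⟩

section Ray

variable {E : Type*} [NormedAddCommGroup E] [InnerProductSpace ℝ E]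

lemma norm_ray_sq (A a : E) {e : E} (he : ‖e‖ = 1) (s : ℝ) :
    ‖A + s • e - a‖ ^ 2 = s ^ 2 + 2 * s * inner ℝ (A - a) e + ‖A - a‖ ^ 2 := by
  have : A + s • e - a = (A - a) + s • e := by abel
  rw [this, norm_add_sq_real, inner_smul_right, norm_smul, he, Real.norm_eq_abs, mul_one, sq_abs]
  ring

/-- Let `a` be at least as far from `A` as every point of `T`. On the ray from `A` in direction
`e`, the points where `a` determines the function `bump` of `insert a T` form an interval, and
beyond this interval the function vanishes: the points of the ray that are closer to `a` than to a
given point of `T` form an up-closed set. -/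
lemma exists_cell_on_ray [DecidableEq E] {ρ : ℝ} (hρ : 0 ≤ ρ) (A a : E) {e : E} (he : ‖e‖ = 1)
    {T : Finset E} (hfar : ∀ b ∈ T, ‖A - b‖ ≤ ‖A - a‖) {L : ℝ} (hL : 0 ≤ L) :
    ∃ p q, 0 ≤ p ∧ p ≤ q ∧ q ≤ L ∧
      (∀ s ∈ Set.Ioc 0 L, s ∉ Set.Icc p q → bump ρ (insert a T) (A + s • e) =
        bump ρ T (A + s • e)) ∧
      (∀ s ∈ Set.Ioo p q, bump ρ (insert a T) (A + s • e) = ρ ^ 2 - ‖A + s • e - a‖ ^ 2) ∧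
      (p < q → ∀ s ∈ Set.Ioc q L, bump ρ (insert a T) (A + s • e) = 0) := by
  set S : Set ℝ := {s | s ∈ Set.Ioc 0 L ∧ ‖A + s • e - a‖ < ρ ∧
    ∀ b ∈ T, ‖A + s • e - a‖ ≤ ‖A + s • e - b‖} with hSdef
  have key : ∀ b ∈ T, ∀ s t : ℝ, 0 < s → s ≤ t → ‖A + s • e - a‖ ≤ ‖A + s • e - b‖ →
      ‖A + t • e - a‖ ≤ ‖A + t • e - b‖ := by
    intro b hb s t hs hst h
    have h1 := pow_le_pow_left₀ (norm_nonneg _) h 2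
    have h2 := pow_le_pow_left₀ (norm_nonneg _) (hfar b hb) 2
    refine le_of_sq_le_sq ?_ (norm_nonneg _)
    rw [norm_ray_sq A _ he, norm_ray_sq A _ he] at *
    have h3 : inner ℝ (A - a) e ≤ inner ℝ (A - b) e := by
      by_contra hcon
      push Not at hcon
      nlinarith
    nlinarith
  have hSc : S.OrdConnected := by
    refine ⟨fun s hs t ht x hx => ⟨⟨hs.1.1.trans_le hx.1, hx.2.trans ht.1.2⟩, ?_, fun b hb =>
      key b hb s x hs.1.1 hx.1 (hs.2.2 b hb)⟩⟩
    have h1 := pow_lt_pow_left₀ hs.2.1 (norm_nonneg _) two_ne_zero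
    have h2 := pow_lt_pow_left₀ ht.2.1 (norm_nonneg _) two_ne_zero
    refine lt_of_pow_lt_pow_left₀ 2 hρ ?_
    rw [norm_ray_sq A _ he] at *
    by_contra hcon
    push Not at hcon
    have h3 : 0 < (x - s) * (x + s + 2 * inner ℝ (A - a) e) := by nlinarith
    have h4 : 0 < (x - t) * (x + t + 2 * inner ℝ (A - a) e) := by nlinarith
    have h5 : 0 < x + s + 2 * inner ℝ (A - a) e := by
      by_contra h'
      nlinarith [hx.1]
    nlinarith [hx.1, hx.2]
  obtain ⟨p, q, hp, hpq, hq, h1, h2⟩ := exists_Ioo_subset_subset_Icc hL (S := S)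
    (fun s hs => ⟨hs.1.1.le, hs.1.2⟩) hSc
  refine ⟨p, q, hp, hpq, hq, ?_, ?_, ?_⟩
  · intro s hs hsn
    have hns : s ∉ S := fun h => hsn (h2 h)
    refine le_antisymm (bump_le (bump_nonneg _ _ _) fun b hb => ?_)
      (bump_mono _ (Finset.subset_insert _ _) _)
    rcases Finset.mem_insert.1 hb with rfl | hb
    · by_cases h3 : ‖A + s • e - b‖ < ρ
      · have : ¬ ∀ b' ∈ T, ‖A + s • e - b‖ ≤ ‖A + s • e - b'‖ := fun h => hns ⟨hs, h3, h⟩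
        push Not at this
        obtain ⟨b', hb', hlt⟩ := this
        have := le_bump ρ hb' (A + s • e)
        nlinarith [norm_nonneg (A + s • e - b')]
      · have := bump_nonneg ρ T (A + s • e)
        nlinarith
    · exact le_bump ρ hb _
  · intro s hs
    obtain ⟨-, h3, h4⟩ := h1 hs
    refine le_antisymm (bump_le (by nlinarith [norm_nonneg (A + s • e - a)]) fun b hb => ?_)
      (le_bump ρ (Finset.mem_insert_self _ _) _)
    rcases Finset.mem_insert.1 hb with rfl | hb
    · exact le_rfl
    · nlinarith [h4 b hb, norm_nonneg (A + s • e - a)]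
  · intro hlt s hs
    have hmid : (p + q) / 2 ∈ S := h1 ⟨by linarith, by linarith⟩
    have hcl : ∀ b ∈ T, ‖A + s • e - a‖ ≤ ‖A + s • e - b‖ := fun b hb =>
      key b hb _ s hmid.1.1 (by linarith [hs.1]) (hmid.2.2 b hb)
    have hge : ρ ≤ ‖A + s • e - a‖ := by
      by_contra hcon
      have : s ∈ S := ⟨⟨by linarith [hs.1], hs.2⟩, not_le.1 hcon, hcl⟩
      linarith [(h2 this).2, hs.1]
    refine bump_eq_zero hρ fun b hb => ?_
    rcases Finset.mem_insert.1 hb with rfl | hb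
    · exact hge
    · exact hge.trans (hcl b hb)

lemma integral_congr_Ioo {f g : ℝ → ℝ} {a b : ℝ} (hab : a ≤ b) (hf : Continuous f)
    (hg : Continuous g) (h : ∀ x ∈ Set.Ioo a b, f x = g x) :
    ∫ x in a..b, f x = ∫ x in a..b, g x :=
  le_antisymm
    (intervalIntegral.integral_mono_on_of_le_Ioo hab (hf.intervalIntegrable _ _)
      (hg.intervalIntegrable _ _) fun x hx => (h x hx).le)
    (intervalIntegral.integral_mono_on_of_le_Ioo hab (hg.intervalIntegrable _ _)
      (hf.intervalIntegrable _ _) fun x hx => (h x hx).ge)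

lemma continuous_bump_ray (ρ : ℝ) (T : Finset E) (A e : E) :
    Continuous fun s : ℝ => bump ρ T (A + s • e) :=
  (continuous_bump ρ T).comp (by fun_prop)

/-- The effect on the integral along a ray of adding a farthest point `a` to `T`. -/
lemma exists_integral_bump_insert [DecidableEq E] {ρ : ℝ} (hρ : 0 ≤ ρ) (A a : E) {e : E}
    (he : ‖e‖ = 1) {T : Finset E} (hfar : ∀ b ∈ T, ‖A - b‖ ≤ ‖A - a‖) {L : ℝ} (hL : 0 ≤ L) :
    ∃ p q, 0 ≤ p ∧ p ≤ q ∧ q ≤ L ∧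
      (∫ s in 0..L, bump ρ (insert a T) (A + s • e) = (∫ s in 0..L, bump ρ T (A + s • e)) -
        (∫ s in p..q, bump ρ T (A + s • e)) + ∫ s in p..q, (ρ ^ 2 - ‖A + s • e - a‖ ^ 2)) ∧
      (p < q → ∫ s in 0..L, bump ρ (insert a T) (A + s • e) ≤ ρ ^ 2 * p +
        ∫ s in p..q, (ρ ^ 2 - ‖A + s • e - a‖ ^ 2)) := by
  obtain ⟨p, q, hp, hpq, hq, h1, h2, h3⟩ := exists_cell_on_ray hρ A a he hfar hL
  have hi : ∀ T : Finset E, ∀ a b : ℝ, IntervalIntegrable (fun s => bump ρ T (A + s • e))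
      volume a b := fun T a b => (continuous_bump_ray ρ T A e).intervalIntegrable _ _
  have split : ∀ T : Finset E, ∫ s in 0..L, bump ρ T (A + s • e) =
      (∫ s in 0..p, bump ρ T (A + s • e)) + (∫ s in p..q, bump ρ T (A + s • e)) +
        ∫ s in q..L, bump ρ T (A + s • e) := fun T => by
    rw [intervalIntegral.integral_add_adjacent_intervals (hi _ _ _) (hi _ _ _),
      intervalIntegral.integral_add_adjacent_intervals (hi _ _ _) (hi _ _ _)]
  have m1 : ∫ s in p..q, bump ρ (insert a T) (A + s • e) =
      ∫ s in p..q, (ρ ^ 2 - ‖A + s • e - a‖ ^ 2) :=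
    integral_congr_Ioo hpq (continuous_bump_ray _ _ _ _) (by fun_prop) h2
  refine ⟨p, q, hp, hpq, hq, ?_, fun hlt => ?_⟩
  · have m2 : ∫ s in 0..p, bump ρ (insert a T) (A + s • e) =
        ∫ s in 0..p, bump ρ T (A + s • e) :=
      integral_congr_Ioo hp (continuous_bump_ray _ _ _ _) (continuous_bump_ray _ _ _ _)
        fun s hs => h1 s ⟨hs.1, by linarith [hs.2]⟩ fun h => by linarith [h.1, hs.2]
    have m3 : ∫ s in q..L, bump ρ (insert a T) (A + s • e) =
        ∫ s in q..L, bump ρ T (A + s • e) :=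
      integral_congr_Ioo hq (continuous_bump_ray _ _ _ _) (continuous_bump_ray _ _ _ _)
        fun s hs => h1 s ⟨by linarith [hs.1], hs.2.le⟩ fun h => by linarith [h.2, hs.1]
    rw [split (insert a T), split T, m1, m2, m3]
    ring
  · have m2 : ∫ s in 0..p, bump ρ (insert a T) (A + s • e) ≤ ∫ s in 0..p, ρ ^ 2 :=
      intervalIntegral.integral_mono_on hp (hi _ _ _) (by simp) fun s _ => bump_le_sq _ _ _
    have m3 : ∫ s in q..L, bump ρ (insert a T) (A + s • e) = ∫ s in q..L, 0 :=
      integral_congr_Ioo hq (continuous_bump_ray _ _ _ _) continuous_const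
        fun s hs => h3 hlt s ⟨hs.1, hs.2.le⟩
    rw [split (insert a T), m1, m3]
    simp at m2 ⊢
    linarith

lemma integral_segment (ρ : ℝ) (A a : E) {e : E} (he : ‖e‖ = 1) (p q : ℝ) :
    ∫ s in p..q, (ρ ^ 2 - ‖A + s • e - a‖ ^ 2) = (ρ ^ 2 - ‖A - a‖ ^ 2) * (q - p) -
      inner ℝ (A - a) e * (q ^ 2 - p ^ 2) - (q ^ 3 - p ^ 3) / 3 := by
  have : ∀ s ∈ Set.uIcc p q, HasDerivAt (fun s : ℝ => (ρ ^ 2 - ‖A - a‖ ^ 2) * s -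
      inner ℝ (A - a) e * s ^ 2 - s ^ 3 / 3) (ρ ^ 2 - ‖A + s • e - a‖ ^ 2) s := by
    intro s _
    have h := (((hasDerivAt_id s).const_mul (ρ ^ 2 - ‖A - a‖ ^ 2)).sub
      ((hasDerivAt_pow 2 s).const_mul (inner ℝ (A - a) e))).sub ((hasDerivAt_pow 3 s).div_const 3)
    refine h.congr_deriv ?_
    rw [norm_ray_sq A a he]
    push_cast
    ring
  rw [intervalIntegral.integral_eq_sub_of_hasDerivAt this
    (Continuous.intervalIntegrable (by fun_prop) _ _)]
  ring

end Ray

/-! ### The second moment of a pair of segments on the two sides of an angle -/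

/-- The second moment about its centroid of the union of the segments `[x, x + u]` and
`[y, y + v]`, laid off from the vertex on the two sides of an angle with cosine `1 - 2 c²`. For
`u = v = 0` the division by zero gives the correct value `0`. -/
noncomputable def segCost (c x y u v : ℝ) : ℝ :=
  (u ^ 3 + v ^ 3) / 12 + u * v / (u + v) *
    ((x + u / 2 + (y + v / 2)) ^ 2 - 4 * (1 - c ^ 2) * (x + u / 2) * (y + v / 2))

section SegCost

variable {c κ x y u v : ℝ}

lemma segCost_eq (hw : 0 < u + v) : segCost c x y u v = (u + v) ^ 3 / 12 +
    u * v / (u + v) * ((x + u / 2 + (y + v / 2)) ^ 2 - 4 * (1 - c ^ 2) * (x + u / 2) * (y + v / 2)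
      - (u + v) ^ 2 / 4) := by
  unfold segCost
  field_simp
  ring

lemma cross_ge (hc1 : c ^ 2 ≤ 1) :
    c ^ 2 * (x + y + (u + v) / 2) ^ 2 ≤
      (x + u / 2 + (y + v / 2)) ^ 2 - 4 * (1 - c ^ 2) * (x + u / 2) * (y + v / 2) := by
  nlinarith [mul_nonneg (sub_nonneg.2 hc1) (sq_nonneg (x + u / 2 - (y + v / 2)))]

lemma mul_div_le (hw : 0 < u + v) : u * v / (u + v) ≤ (u + v) / 4 := by
  rw [div_le_iff₀ hw]
  nlinarith [sq_nonneg (u - v)]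

/-- Among all pairs of segments of given total length, the pair of equal segments starting at the
vertex has the least second moment. -/
lemma segCost_ge (hc1 : c ^ 2 ≤ 1) (hκ : κ ^ 2 = (3 * c ^ 2 + 1) / 4)
    (hx : 0 ≤ x) (hy : 0 ≤ y) (hu : 0 ≤ u) (hv : 0 ≤ v) (hw : 0 < u + v) :
    κ ^ 2 * (u + v) ^ 3 / 12 ≤ segCost c x y u v := by
  rw [segCost_eq hw, hκ]
  have h1 := cross_ge (x := x) (y := y) (u := u) (v := v) hc1
  have h2 := mul_div_le hw
  have h0 : 0 ≤ u * v / (u + v) := by positivity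
  have h3 : c ^ 2 * ((u + v) / 2) ^ 2 ≤ c ^ 2 * (x + y + (u + v) / 2) ^ 2 := by
    gcongr; linarith
  have h4 : u * v / (u + v) * (-(1 - c ^ 2) * (u + v) ^ 2 / 4) ≤ u * v / (u + v) *
    ((x + u / 2 + (y + v / 2)) ^ 2 - 4 * (1 - c ^ 2) * (x + u / 2) * (y + v / 2)
      - (u + v) ^ 2 / 4) := by
    gcongr; linarith
  have h5 : 0 ≤ (1 - c ^ 2) * (u + v) ^ 2 := mul_nonneg (by linarith) (sq_nonneg _)
  nlinarith

lemma segCost_eq_iff (hc0 : 0 < c) (hc1 : c < 1) (hκ : κ ^ 2 = (3 * c ^ 2 + 1) / 4)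
    (hx : 0 ≤ x) (hy : 0 ≤ y) (hu : 0 ≤ u) (hv : 0 ≤ v) (hw : 0 < u + v)
    (h : segCost c x y u v = κ ^ 2 * (u + v) ^ 3 / 12) : u = v ∧ x = 0 ∧ y = 0 := by
  have hc2 : c ^ 2 < 1 := by nlinarith
  rw [segCost_eq hw, hκ] at h
  have h1 := cross_ge (x := x) (y := y) (u := u) (v := v) hc2.le
  have h2 := mul_div_le hw
  have h0 : 0 ≤ u * v / (u + v) := by positivity
  have h4 : u * v / (u + v) * (c ^ 2 * (x + y + (u + v) / 2) ^ 2 - (u + v) ^ 2 / 4) ≤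
    u * v / (u + v) *
    ((x + u / 2 + (y + v / 2)) ^ 2 - 4 * (1 - c ^ 2) * (x + u / 2) * (y + v / 2)
      - (u + v) ^ 2 / 4) := by
    gcongr
  have h5 : 0 < (1 - c ^ 2) * (u + v) ^ 2 := mul_pos (by linarith) (by positivity)
  have h6 : 0 ≤ c ^ 2 * ((x + y) ^ 2 + (x + y) * (u + v)) := by positivity
  have h7 : (u + v) / 4 ≤ u * v / (u + v) := by
    nlinarith [mul_nonneg h0 h6]
  have h8 : u = v := by
    rw [le_div_iff₀ hw] at h7
    have : (u - v) ^ 2 = 0 := le_antisymm (by nlinarith) (sq_nonneg _)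
    nlinarith [pow_eq_zero_iff (two_ne_zero) |>.1 this]
  have h9 : 0 < c ^ 2 := by positivity
  have h10 : u * v / (u + v) = (u + v) / 4 := le_antisymm h2 h7
  rw [h10] at h h4
  have h11 : c ^ 2 * ((x + y) * (u + v)) ≤ 0 := by
    by_contra hcon
    push Not at hcon
    have : 0 ≤ c ^ 2 * (x + y) ^ 2 := by positivity
    nlinarith
  have h12 : x + y ≤ 0 := by
    by_contra hcon
    push Not at hcon
    have : 0 < c ^ 2 * ((x + y) * (u + v)) := by positivity
    linarith
  exact ⟨h8, by linarith, by linarith⟩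

/-- Either a pair of segments has at least the second moment of one segment of the same total
length, or it begins so close to the vertex that its second moment also pays for the two segments
between it and the vertex. -/
lemma segCost_dichotomy (hc0 : 1 / 2 ≤ c) (hc1 : c < 1) (hκ0 : 0 < κ)
    (hκ : κ ^ 2 = (3 * c ^ 2 + 1) / 4)
    (hx : 0 ≤ x) (hy : 0 ≤ y) (hu : 0 ≤ u) (hv : 0 ≤ v) (hw : 0 < u + v) :
    (u + v) ^ 3 / 12 ≤ segCost c x y u v ∨
      κ ^ 2 * (x + y + (u + v)) ^ 3 / (12 * (1 + κ) ^ 2) < segCost c x y u v := by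
  have hc2 : c ^ 2 < 1 := by nlinarith
  have hc3 : 1 / 4 ≤ c ^ 2 := by nlinarith
  have hκ1 : 1 / 2 < κ := by nlinarith
  rw [or_iff_not_imp_left]
  intro hlt
  rw [segCost_eq hw] at *
  have h1 := cross_ge (x := x) (y := y) (u := u) (v := v) hc2.le
  have h2 := mul_div_le hw
  have h0 : 0 ≤ u * v / (u + v) := by positivity
  set w := u + v with hwdef
  set z := x + y with hz
  set G := u * v / w
  have hz0 : 0 ≤ z := by positivity
  -- the midpoints are closer than for two adjacent segments of a line, whence `2 z < w`
  have hneg : c ^ 2 * (z + w / 2) ^ 2 < w ^ 2 / 4 := by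
    by_contra hcon
    push Not at hcon
    exact hlt (le_add_of_nonneg_right (mul_nonneg h0 (by linarith)))
  have hzw : 2 * z < w := by
    by_contra hcon
    have h3 : w ^ 2 ≤ (z + w / 2) ^ 2 := by gcongr; linarith
    have h4 := mul_le_mul hc3 h3 (sq_nonneg w) (sq_nonneg c)
    linarith
  have h4 : G * (c ^ 2 * (z + w / 2) ^ 2 - w ^ 2 / 4) ≤ G *
    ((x + u / 2 + (y + v / 2)) ^ 2 - 4 * (1 - c ^ 2) * (x + u / 2) * (y + v / 2)
      - w ^ 2 / 4) := by
    gcongr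
  have h5 : w / 4 * (c ^ 2 * (z + w / 2) ^ 2 - w ^ 2 / 4) ≤
      G * (c ^ 2 * (z + w / 2) ^ 2 - w ^ 2 / 4) :=
    mul_le_mul_of_nonpos_right h2 (by linarith)
  have h6 : κ ^ 2 * (z + w) * w ^ 2 / 12 ≤ w ^ 3 / 12 +
      w / 4 * (c ^ 2 * (z + w / 2) ^ 2 - w ^ 2 / 4) := by
    rw [hκ]
    have h61 : 0 ≤ 9 * c ^ 2 - 1 := by linarith
    have h62 : 0 ≤ w * (z * w * (9 * c ^ 2 - 1) + 12 * c ^ 2 * z ^ 2) := by positivity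
    linear_combination (1 / 48) * h62
  have h7 : κ ^ 2 * (z + w) ^ 3 / (12 * (1 + κ) ^ 2) < κ ^ 2 * (z + w) * w ^ 2 / 12 := by
    rw [div_lt_div_iff₀ (by positivity) (by norm_num)]
    have h8 : z + w < (1 + κ) * w := by
      linarith [mul_lt_mul_of_pos_right hκ1 hw]
    have h9 : (z + w) ^ 2 < ((1 + κ) * w) ^ 2 := by gcongr
    have h10 : 0 < 12 * κ ^ 2 * (z + w) := by positivity
    linear_combination mul_lt_mul_of_pos_left h9 h10
  linarith

/-- A pair of two genuine segments that is separated from the vertex by at least its own length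
has a larger second moment than one segment of the same total length. -/
lemma segCost_gt (hc0 : 1 / 2 ≤ c) (hc1 : c < 1) (hu : 0 < u) (hv : 0 < v)
    (h : u + v ≤ x + y) : (u + v) ^ 3 / 12 < segCost c x y u v := by
  have hw : 0 < u + v := by positivity
  rw [segCost_eq hw]
  have hc2 : c ^ 2 < 1 := by nlinarith
  have hc3 : 1 / 4 ≤ c ^ 2 := by nlinarith
  have h1 := cross_ge (x := x) (y := y) (u := u) (v := v) hc2.le
  have h0 : 0 < u * v / (u + v) := by positivity
  have h2 : ((u + v) * (3 / 2)) ^ 2 ≤ (x + y + (u + v) / 2) ^ 2 := by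
    gcongr; linarith
  have : 0 < (x + u / 2 + (y + v / 2)) ^ 2 - 4 * (1 - c ^ 2) * (x + u / 2) * (y + v / 2)
      - (u + v) ^ 2 / 4 := by nlinarith [sq_pos_of_pos hw]
  nlinarith [mul_pos h0 this]

/-- The concave function `w ↦ ρ² w - w³ / (12 θ²)` is at most `4/3 ρ³ θ`. -/
lemma sub_cube_le {ρ θ w : ℝ} (hρ : 0 < ρ) (hθ : 0 < θ) (hw : 0 ≤ w) :
    ρ ^ 2 * w - w ^ 3 / (12 * θ ^ 2) ≤ 4 / 3 * ρ ^ 3 * θ := by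
  have : 4 / 3 * ρ ^ 3 * θ - (ρ ^ 2 * w - w ^ 3 / (12 * θ ^ 2)) =
    (w - 2 * ρ * θ) ^ 2 * (w + 4 * ρ * θ) / (12 * θ ^ 2) := by
    field_simp
    ring
  have h2 : 0 ≤ (w - 2 * ρ * θ) ^ 2 * (w + 4 * ρ * θ) / (12 * θ ^ 2) := by positivity
  linarith

lemma sub_cube_eq {ρ θ w : ℝ} (hρ : 0 < ρ) (hθ : 0 < θ) (hw : 0 ≤ w)
    (h : 4 / 3 * ρ ^ 3 * θ ≤ ρ ^ 2 * w - w ^ 3 / (12 * θ ^ 2)) : w = 2 * ρ * θ := by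
  have : 4 / 3 * ρ ^ 3 * θ - (ρ ^ 2 * w - w ^ 3 / (12 * θ ^ 2)) =
    (w - 2 * ρ * θ) ^ 2 * (w + 4 * ρ * θ) / (12 * θ ^ 2) := by
    field_simp
    ring
  have h2 : 0 ≤ (w - 2 * ρ * θ) ^ 2 * (w + 4 * ρ * θ) / (12 * θ ^ 2) := by positivity
  have h3 : (w - 2 * ρ * θ) ^ 2 * (w + 4 * ρ * θ) / (12 * θ ^ 2) = 0 := by linarith
  have h4 : w + 4 * ρ * θ ≠ 0 := by positivity
  have h5 : (12 * θ ^ 2) ≠ 0 := by positivity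
  simp only [div_eq_zero_iff, mul_eq_zero, h4, h5, or_false] at h3
  have := pow_eq_zero_iff (two_ne_zero) |>.1 h3
  linarith

end SegCost

/-! ### The corner inequality -/

section Corner

variable {E : Type*} [NormedAddCommGroup E] [InnerProductSpace ℝ E]

/-- The integral of `bump ρ T` over the two segments of length `L` that start at `A` in the
directions `e₁` and `e₂`. -/
noncomputable def cornerMass (ρ L : ℝ) (A e₁ e₂ : E) (T : Finset E) : ℝ :=
  (∫ s in 0..L, bump ρ T (A + s • e₁)) + ∫ s in 0..L, bump ρ T (A + s • e₂)

/-- The parallel axis theorem for two segments on the sides of an angle. -/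
lemma integral_two_segments (ρ : ℝ) (A a : E) {e₁ e₂ : E} (h₁ : ‖e₁‖ = 1) (h₂ : ‖e₂‖ = 1)
    {c : ℝ} (h12 : inner ℝ e₁ e₂ = 1 - 2 * c ^ 2) {x y u v : ℝ} (hw : 0 < u + v) :
    (∫ s in x..(x + u), (ρ ^ 2 - ‖A + s • e₁ - a‖ ^ 2)) +
      (∫ s in y..(y + v), (ρ ^ 2 - ‖A + s • e₂ - a‖ ^ 2)) =
    ρ ^ 2 * (u + v) - segCost c x y u v - (u + v) *
      ‖A - a + ((u * (x + u / 2) / (u + v)) • e₁ + (v * (y + v / 2) / (u + v)) • e₂)‖ ^ 2 := by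
  rw [integral_segment _ _ _ h₁, integral_segment _ _ _ h₂, norm_add_sq_real (A - a),
    norm_add_sq_real, inner_add_right]
  simp only [inner_smul_right, inner_smul_left, norm_smul, h₁, h₂, mul_one, Real.norm_eq_abs,
    sq_abs, h12, conj_trivial]
  unfold segCost
  field_simp
  ring

/-- The distance from the points of one side of an angle to `A + (r / 4) (e₁ + e₂)`, the centroid
of the two segments of length `r` at the vertex `A`. -/
lemma norm_sub_cornerPoint_sq (A : E) {e₁ e₂ : E} (h₁ : ‖e₁‖ = 1) (h₂ : ‖e₂‖ = 1)
    {c : ℝ} (h12 : inner ℝ e₁ e₂ = 1 - 2 * c ^ 2) (r s : ℝ) :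
    ‖A + s • e₁ - (A + (r / 4) • (e₁ + e₂))‖ ^ 2 =
      (3 * c ^ 2 + 1) / 4 * r ^ 2 + (s - r) * (s + r * c ^ 2) := by
  have : A + s • e₁ - (A + (r / 4) • (e₁ + e₂)) = (s - r / 4) • e₁ + (-(r / 4)) • e₂ := by
    module
  rw [this, norm_add_sq_real]
  simp only [inner_smul_right, inner_smul_left, norm_smul, h₁, h₂, mul_one, Real.norm_eq_abs,
    sq_abs, h12, conj_trivial]
  ring

lemma norm_sub_cornerPoint_lt (A : E) {e₁ e₂ : E} (h₁ : ‖e₁‖ = 1) (h₂ : ‖e₂‖ = 1)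
    {c : ℝ} (h12 : inner ℝ e₁ e₂ = 1 - 2 * c ^ 2) (hc : c ≠ 0) {κ ρ r s : ℝ}
    (hκ : κ ^ 2 = (3 * c ^ 2 + 1) / 4) (hρ : ρ = κ * r) (hρ0 : 0 ≤ ρ) (hr : 0 < r)
    (hs : 0 ≤ s) (hsr : s < r) :
    ‖A + s • e₁ - (A + (r / 4) • (e₁ + e₂))‖ < ρ := by
  refine lt_of_pow_lt_pow_left₀ 2 hρ0 ?_
  rw [norm_sub_cornerPoint_sq A h₁ h₂ h12, ← hκ, hρ]
  have : 0 < r * c ^ 2 := by positivity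
  nlinarith [mul_pos (sub_pos.2 hsr) (add_pos_of_nonneg_of_pos hs this)]

lemma le_of_integral_bump_eq_zero {ρ r p q : ℝ} {T : Finset E} {A e : E} (hp : 0 ≤ p)
    (hpq : p < q) (hpos : ∀ s, 0 ≤ s → s < r → 0 < bump ρ T (A + s • e))
    (h0 : ∫ s in p..q, bump ρ T (A + s • e) = 0) : r ≤ p := by
  by_contra hcon
  push Not at hcon
  have := intervalIntegral.integral_pos hpq (continuous_bump_ray ρ T A e).continuousOn
    (fun s _ => bump_nonneg _ _ _) ⟨p, ⟨le_rfl, hpq.le⟩, hpos p hp hcon⟩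
  linarith

lemma integral_bump_nonneg (ρ : ℝ) (T : Finset E) (A e : E) {p q : ℝ} (h : p ≤ q) :
    0 ≤ ∫ s in p..q, bump ρ T (A + s • e) :=
  intervalIntegral.integral_nonneg h fun _ _ => bump_nonneg _ _ _

/-- One centre in a corner. -/
lemma cornerMass_singleton_le {ρ L c κ r : ℝ} (hρ0 : 0 < ρ) (hL : 0 ≤ L) (hc0 : 1 / 2 ≤ c)
    (hc1 : c < 1) (hκ0 : 0 < κ) (hκ : κ ^ 2 = (3 * c ^ 2 + 1) / 4) (hρ : ρ = κ * r)
    (A : E) {e₁ e₂ : E} (h₁ : ‖e₁‖ = 1) (h₂ : ‖e₂‖ = 1)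
    (h12 : inner ℝ e₁ e₂ = 1 - 2 * c ^ 2) (a : E) :
    cornerMass ρ L A e₁ e₂ {a} ≤ 4 / 3 * ρ ^ 3 * (1 / κ) ∧
      (cornerMass ρ L A e₁ e₂ {a} = 4 / 3 * ρ ^ 3 * (1 / κ) →
        a = A + (r / 4) • (e₁ + e₂)) := by
  classical
  obtain ⟨x, q₁, hx, hq₁, -, hi₁, -⟩ := exists_integral_bump_insert hρ0.le A a h₁ (T := ∅)
    (by simp) hL
  obtain ⟨y, q₂, hy, hq₂, -, hi₂, -⟩ := exists_integral_bump_insert hρ0.le A a h₂ (T := ∅)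
    (by simp) hL
  obtain ⟨u, rfl⟩ : ∃ u, q₁ = x + u := ⟨q₁ - x, by ring⟩
  obtain ⟨v, rfl⟩ : ∃ v, q₂ = y + v := ⟨q₂ - y, by ring⟩
  have hu : 0 ≤ u := by linarith
  have hv : 0 ≤ v := by linarith
  simp only [bump_empty, intervalIntegral.integral_zero, sub_zero, zero_add,
    insert_empty_eq] at hi₁ hi₂
  have hM : 0 < 4 / 3 * ρ ^ 3 * (1 / κ) := by positivity
  have heq : cornerMass ρ L A e₁ e₂ {a} = (∫ s in x..(x + u), (ρ ^ 2 - ‖A + s • e₁ - a‖ ^ 2)) +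
      (∫ s in y..(y + v), (ρ ^ 2 - ‖A + s • e₂ - a‖ ^ 2)) := by
    rw [cornerMass, hi₁, hi₂]
  rcases (add_nonneg hu hv).eq_or_lt with hw | hw
  · have hu0 : u = 0 := by linarith
    have hv0 : v = 0 := by linarith
    have : cornerMass ρ L A e₁ e₂ {a} = 0 := by rw [heq, hu0, hv0]; simp
    exact ⟨by linarith, fun h => by linarith⟩
  rw [integral_two_segments ρ A a h₁ h₂ h12 hw] at heq
  have hc2 : c ^ 2 ≤ 1 := by nlinarith
  have hcost := segCost_ge hc2 hκ hx hy hu hv hw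
  have hn : 0 ≤ (u + v) *
      ‖A - a + ((u * (x + u / 2) / (u + v)) • e₁ + (v * (y + v / 2) / (u + v)) • e₂)‖ ^ 2 := by
    positivity
  have hθ : 0 < 1 / κ := by positivity
  have hcub := sub_cube_le hρ0 hθ hw.le
  have hrw : (u + v) ^ 3 / (12 * (1 / κ) ^ 2) = κ ^ 2 * (u + v) ^ 3 / 12 := by
    field_simp
  refine ⟨by linarith, fun h => ?_⟩
  have hw2 := sub_cube_eq hρ0 hθ hw.le (by linarith)
  obtain ⟨huv, hx0, hy0⟩ := segCost_eq_iff (by linarith) hc1 hκ hx hy hu hv hw (by linarith)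
  have hn0 : (u + v) * ‖A - a + ((u * (x + u / 2) / (u + v)) • e₁ +
      (v * (y + v / 2) / (u + v)) • e₂)‖ ^ 2 = 0 := by linarith
  have hn1 := (mul_eq_zero.1 hn0).resolve_left hw.ne'
  have hn2 := norm_eq_zero.1 (pow_eq_zero_iff (two_ne_zero) |>.1 hn1)
  have hur : u = r := by
    have : 2 * ρ * (1 / κ) = 2 * r := by rw [hρ]; field_simp
    linarith
  have hu0 : u ≠ 0 := by intro h0; rw [← huv, h0] at hw; simp at hw
  have e1 : u * (x + u / 2) / (u + v) = r / 4 := by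
    rw [← huv, hx0, ← hur]; field_simp; ring
  have e2 : v * (y + v / 2) / (u + v) = r / 4 := by
    rw [← huv, hy0, ← hur]; field_simp; ring
  rw [e1, e2] at hn2
  rw [smul_add, ← sub_eq_zero, ← neg_eq_zero, ← hn2]
  abel

/-- `n` centres capture at most `n - 1 + 1 / κ` times the mass `4/3 ρ³` that one centre captures on
a line; equality forces one centre into the corner and the others onto the two rays. The centre
`a` farthest from the vertex is removed: its cell begins at some point of each ray and nothing is
captured beyond it. Either the cell captures at most `4/3 ρ³`, or `segCost_dichotomy` bounds
everything captured by all centres together. -/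
theorem cornerMass_le {ρ L c κ r : ℝ} (hρ0 : 0 < ρ) (hL : 0 ≤ L) (hc0 : 1 / 2 ≤ c)
    (hc1 : c < 1) (hκ0 : 0 < κ) (hκ : κ ^ 2 = (3 * c ^ 2 + 1) / 4) (hρ : ρ = κ * r)
    (A : E) {e₁ e₂ : E} (h₁ : ‖e₁‖ = 1) (h₂ : ‖e₂‖ = 1)
    (h12 : inner ℝ e₁ e₂ = 1 - 2 * c ^ 2) (n : ℕ) :
    ∀ T : Finset E, T.card = n + 1 →
    cornerMass ρ L A e₁ e₂ T ≤ 4 / 3 * ρ ^ 3 * (n + 1 / κ) ∧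
      (cornerMass ρ L A e₁ e₂ T = 4 / 3 * ρ ^ 3 * (n + 1 / κ) →
        A + (r / 4) • (e₁ + e₂) ∈ T ∧ ∀ a ∈ T, a ≠ A + (r / 4) • (e₁ + e₂) →
          ∃ t, r + ρ ≤ t ∧ t ≤ L - ρ ∧ (a = A + t • e₁ ∨ a = A + t • e₂)) := by
  classical
  have hκ1 : κ ≤ 1 := by nlinarith
  induction n with
  | zero =>
    intro T hT
    obtain ⟨a, rfl⟩ := Finset.card_eq_one.1 hT
    have := cornerMass_singleton_le hρ0 hL hc0 hc1 hκ0 hκ hρ A h₁ h₂ h12 a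
    refine ⟨by simpa using this.1, fun h => ?_⟩
    have ha := this.2 (by simpa using h)
    exact ⟨by simp [ha], fun b hb hne => absurd ((Finset.mem_singleton.1 hb).trans ha) hne⟩
  | succ n ih =>
    intro T' hT'
    have hne : T'.Nonempty := Finset.card_pos.1 (by omega)
    obtain ⟨a, ha, hmax⟩ := T'.exists_max_image (fun b => ‖A - b‖) hne
    set T := T'.erase a with hTdef
    have hTT : T' = insert a T := (Finset.insert_erase ha).symm
    have hcard : T.card = n + 1 := by rw [Finset.card_erase_of_mem ha, hT']; rfl
    have hfar : ∀ b ∈ T, ‖A - b‖ ≤ ‖A - a‖ := fun b hb => hmax b (Finset.mem_of_mem_erase hb)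
    rw [hTT]
    obtain ⟨ihle, iheq⟩ := ih T hcard
    obtain ⟨x, q₁, hx, hq₁, hL₁, hi₁, hj₁⟩ := exists_integral_bump_insert hρ0.le A a h₁ hfar hL
    obtain ⟨y, q₂, hy, hq₂, hL₂, hi₂, hj₂⟩ := exists_integral_bump_insert hρ0.le A a h₂ hfar hL
    obtain ⟨u, rfl⟩ : ∃ u, q₁ = x + u := ⟨q₁ - x, by ring⟩
    obtain ⟨v, rfl⟩ : ∃ v, q₂ = y + v := ⟨q₂ - y, by ring⟩
    have hu : 0 ≤ u := by linarith
    have hv : 0 ≤ v := by linarith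
    have hB₁ := integral_bump_nonneg ρ T A e₁ hq₁
    have hB₂ := integral_bump_nonneg ρ T A e₂ hq₂
    have hM : 0 < 4 / 3 * ρ ^ 3 := by positivity
    have hgoal : 4 / 3 * ρ ^ 3 * (((n + 1 : ℕ) : ℝ) + 1 / κ) =
      4 / 3 * ρ ^ 3 * (n + 1 / κ) + 4 / 3 * ρ ^ 3 := by push_cast; ring
    rw [hgoal]
    have heq : cornerMass ρ L A e₁ e₂ (insert a T) = cornerMass ρ L A e₁ e₂ T -
        (∫ s in x..(x + u), bump ρ T (A + s • e₁)) -
        (∫ s in y..(y + v), bump ρ T (A + s • e₂)) +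
        ((∫ s in x..(x + u), (ρ ^ 2 - ‖A + s • e₁ - a‖ ^ 2)) +
        (∫ s in y..(y + v), (ρ ^ 2 - ‖A + s • e₂ - a‖ ^ 2))) := by
      simp only [cornerMass]; rw [hi₁, hi₂]; ring
    rcases (add_nonneg hu hv).eq_or_lt with hw | hw
    · have hu0 : u = 0 := by linarith
      have hv0 : v = 0 := by linarith
      subst hu0 hv0
      simp only [add_zero, intervalIntegral.integral_same, sub_zero] at heq
      exact ⟨by linarith, fun h => by linarith⟩
    have hseg := integral_two_segments ρ A a h₁ h₂ h12 (x := x) (y := y) hw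
    have hn : 0 ≤ (u + v) *
        ‖A - a + ((u * (x + u / 2) / (u + v)) • e₁ + (v * (y + v / 2) / (u + v)) • e₂)‖ ^ 2 := by
      positivity
    -- a degenerate pair has exactly the second moment of one segment
    have hdich : (u + v) ^ 3 / 12 ≤ segCost c x y u v ∨ 0 < u ∧ 0 < v ∧
        κ ^ 2 * (x + y + (u + v)) ^ 3 / (12 * (1 + κ) ^ 2) < segCost c x y u v := by
      rcases hu.eq_or_lt with h0 | hu0
      · exact Or.inl (by rw [segCost_eq hw, ← h0]; simp)
      rcases hv.eq_or_lt with h0 | hv0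
      · exact Or.inl (by rw [segCost_eq hw, ← h0]; simp)
      exact (segCost_dichotomy hc0 hc1 hκ0 hκ hx hy hu hv hw).imp_right fun h => ⟨hu0, hv0, h⟩
    rcases hdich with hcost | ⟨hu1, hv1, hcost⟩
    · have hcub := sub_cube_le hρ0 one_pos hw.le
      simp only [one_pow, mul_one] at hcub
      refine ⟨by linarith, fun h => ?_⟩
      have hTeq : cornerMass ρ L A e₁ e₂ T = 4 / 3 * ρ ^ 3 * (n + 1 / κ) := by linarith
      obtain ⟨hcT, hrest⟩ := iheq hTeq
      have hw2 := sub_cube_eq hρ0 one_pos hw.le (by simp only [one_pow, mul_one]; linarith)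
      have hn0 : (u + v) * ‖A - a + ((u * (x + u / 2) / (u + v)) • e₁ +
          (v * (y + v / 2) / (u + v)) • e₂)‖ ^ 2 = 0 := by linarith
      have hn1 := (mul_eq_zero.1 hn0).resolve_left hw.ne'
      have hn2 := norm_eq_zero.1 (pow_eq_zero_iff (two_ne_zero) |>.1 hn1)
      have hz₁ : ∫ s in x..(x + u), bump ρ T (A + s • e₁) = 0 := by linarith
      have hz₂ : ∫ s in y..(y + v), bump ρ T (A + s • e₂) = 0 := by linarith
      have hr : 0 < r := by
        rw [hρ] at hρ0
        exact (mul_pos_iff_of_pos_left hκ0).1 hρ0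
      have hc : c ≠ 0 := by linarith
      have hp₁ : u ≠ 0 → r ≤ x := fun h0 => le_of_integral_bump_eq_zero hx
        (by linarith [lt_of_le_of_ne hu h0.symm]) (fun s hs hsr => bump_pos hcT
          (norm_sub_cornerPoint_lt A h₁ h₂ h12 hc hκ hρ hρ0.le hr hs hsr)) hz₁
      have hp₂ : v ≠ 0 → r ≤ y := fun h0 => le_of_integral_bump_eq_zero hy
        (by linarith [lt_of_le_of_ne hv h0.symm]) (fun s hs hsr => bump_pos hcT (by
          have := norm_sub_cornerPoint_lt A h₂ h₁ (by rwa [real_inner_comm]) hc hκ hρ hρ0.le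
            hr hs hsr
          rwa [add_comm e₂ e₁] at this)) hz₂
      have hρr : ρ ≤ r := by rw [hρ]; exact mul_le_of_le_one_left hr.le hκ1
      refine ⟨Finset.mem_insert_of_mem hcT, fun b hb hbne => ?_⟩
      rcases Finset.mem_insert.1 hb with rfl | hb
      · by_cases hu0 : u = 0
        · have hv0 : v ≠ 0 := by intro h0; rw [hu0, h0] at hw; simp at hw
          refine ⟨y + ρ, by linarith [hp₂ hv0], by linarith, Or.inr ?_⟩
          have e2 : v * (y + v / 2) / (u + v) = y + ρ := by
            rw [hu0, zero_add, mul_div_assoc, mul_div_cancel₀ _ hv0]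
            linarith
          rw [hu0] at hn2 e2
          rw [e2] at hn2
          rw [← sub_eq_zero, ← neg_eq_zero, ← hn2, zero_mul, zero_div, zero_smul]
          abel
        · by_cases hv0 : v = 0
          · refine ⟨x + ρ, by linarith [hp₁ hu0], by linarith, Or.inl ?_⟩
            have e1 : u * (x + u / 2) / (u + v) = x + ρ := by
              rw [hv0, add_zero, mul_div_assoc, mul_div_cancel₀ _ hu0]
              linarith
            rw [hv0] at hn2 e1
            rw [e1] at hn2
            rw [← sub_eq_zero, ← neg_eq_zero, ← hn2, zero_mul, zero_div, zero_smul]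
            abel
          · have := segCost_gt (x := x) (y := y) hc0 hc1 (lt_of_le_of_ne hu (Ne.symm hu0))
              (lt_of_le_of_ne hv (Ne.symm hv0)) (by linarith [hp₁ hu0, hp₂ hv0])
            linarith
      · exact hrest b hb hbne
    · have k₁ := hj₁ (by linarith)
      have k₂ := hj₂ (by linarith)
      have hcub := sub_cube_le hρ0 (θ := 1 + 1 / κ) (by positivity)
        (w := x + y + (u + v)) (by linarith)
      have hrw : (x + y + (u + v)) ^ 3 / (12 * (1 + 1 / κ) ^ 2) =
          κ ^ 2 * (x + y + (u + v)) ^ 3 / (12 * (1 + κ) ^ 2) := by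
        field_simp
        ring
      have hn' : 0 ≤ 4 / 3 * ρ ^ 3 * n := by positivity
      rw [hrw] at hcub
      have hlt : cornerMass ρ L A e₁ e₂ (insert a T) <
          4 / 3 * ρ ^ 3 * (n + 1 / κ) + 4 / 3 * ρ ^ 3 := by
        simp only [cornerMass]
        linarith
      exact ⟨hlt.le, fun h => absurd h hlt.ne⟩

end Corner

/-! ### The sides of the regular polygon -/

section Polygon

variable {m : ℕ}

/-- The vertex of the polygon whose index is the residue `z`. -/
noncomputable def vert (m : ℕ) (z : ZMod m) : Plane := polyVertex m z.val

/-- The angle of the outer normal of the side that starts at the vertex `z`. -/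
noncomputable def sideAngle (m : ℕ) (z : ZMod m) : ℝ :=
  2 * Real.pi / m * ((z.val : ℝ) - 1) + Real.pi / m

/-- The unit vector along the side that starts at the vertex `z`. -/
noncomputable def sideDir (m : ℕ) (z : ZMod m) : Plane :=
  !₂[-Real.sin (sideAngle m z), Real.cos (sideAngle m z)]

/-- The outer unit normal of the side that starts at the vertex `z`. -/
noncomputable def sideNormal (m : ℕ) (z : ZMod m) : Plane :=
  !₂[Real.cos (sideAngle m z), Real.sin (sideAngle m z)]

/-- The parametrization by arc length of the side that starts at the vertex `z`. -/
noncomputable def side (m : ℕ) (z : ZMod m) (s : ℝ) : Plane := vert m z + s • sideDir m z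

lemma angle_mod (hm : m ≠ 0) (j : ℕ) (x : ℝ) : ∃ n : ℤ,
    2 * Real.pi / m * ((j : ℝ) - 1) + x =
      2 * Real.pi / m * (((j % m : ℕ) : ℝ) - 1) + x + n * (2 * Real.pi) := by
  refine ⟨((j / m : ℕ) : ℤ), ?_⟩
  have h : ((j % m : ℕ) : ℝ) + m * (j / m : ℕ) = j := by exact_mod_cast Nat.mod_add_div j m
  have hm' : (m : ℝ) ≠ 0 := by exact_mod_cast hm
  rw [← h, Int.cast_natCast]
  field_simp
  ring

lemma plane_ext {x y : Plane} (h0 : x 0 = y 0) (h1 : x 1 = y 1) : x = y := by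
  ext i; fin_cases i <;> assumption

lemma vert_eq (z : ZMod m) : vert m z =
    Real.cos (Real.pi / m) • sideNormal m z - Real.sin (Real.pi / m) • sideDir m z := by
  have h : 2 * Real.pi / m * ((z.val : ℝ) - 1) = sideAngle m z - Real.pi / m := by
    rw [sideAngle]; ring
  apply plane_ext <;>
  simp only [vert, polyVertex, h, Real.cos_sub, Real.sin_sub, sideNormal, sideDir, PiLp.sub_apply,
    PiLp.smul_apply, smul_eq_mul, PiLp.toLp_apply, Matrix.cons_val_zero, Matrix.cons_val_one,
    Matrix.cons_val_fin_one] <;> ring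

lemma side_eq (z : ZMod m) (s : ℝ) : side m z s = Real.cos (Real.pi / m) • sideNormal m z +
    (s - Real.sin (Real.pi / m)) • sideDir m z := by
  rw [side, vert_eq]
  module

lemma norm_plane_sq (x : Plane) : ‖x‖ ^ 2 = x 0 ^ 2 + x 1 ^ 2 := by
  rw [EuclideanSpace.norm_sq_eq, Fin.sum_univ_two]; simp

lemma norm_sideDir (z : ZMod m) : ‖sideDir m z‖ = 1 := by
  have h : ‖sideDir m z‖ ^ 2 = 1 := by
    rw [norm_plane_sq]
    simp [sideDir]
  exact (pow_eq_one_iff_of_nonneg (norm_nonneg _) two_ne_zero).1 h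

lemma sin_pos_of_three_le (hm : 3 ≤ m) : 0 < Real.sin (Real.pi / m) := by
  have h : (3 : ℝ) ≤ m := by exact_mod_cast hm
  apply Real.sin_pos_of_pos_of_lt_pi
  · exact div_pos Real.pi_pos (by linarith)
  · rw [div_lt_iff₀ (by linarith)]
    nlinarith [Real.pi_pos]

/-- The distance of two points on two sides, in terms of half the angle between the sides. -/
lemma norm_side_sub_side_sq (z w : ZMod m) (s t : ℝ) :
    ‖side m z s - side m w t‖ ^ 2 =
      (2 * Real.cos (Real.pi / m) * Real.sin (Real.pi / m * ((z.val : ℝ) - w.val)) +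
        (s - t) * Real.cos (Real.pi / m * ((z.val : ℝ) - w.val))) ^ 2 +
      (s + t - 2 * Real.sin (Real.pi / m)) ^ 2 *
        Real.sin (Real.pi / m * ((z.val : ℝ) - w.val)) ^ 2 := by
  obtain ⟨g, hg⟩ : ∃ g, g = (sideAngle m z + sideAngle m w) / 2 := ⟨_, rfl⟩
  obtain ⟨h, hh⟩ : ∃ h, h = Real.pi / m * ((z.val : ℝ) - w.val) := ⟨_, rfl⟩
  have hz : sideAngle m z = g + h := by rw [hg, hh, sideAngle, sideAngle]; ring
  have hw : sideAngle m w = g - h := by rw [hg, hh, sideAngle, sideAngle]; ring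
  rw [← hh, norm_plane_sq, side_eq, side_eq]
  simp only [sideNormal, sideDir, PiLp.sub_apply, PiLp.add_apply, hz, hw, Real.cos_add,
    Real.cos_sub, Real.sin_add, Real.sin_sub,
    PiLp.smul_apply, smul_eq_mul, Matrix.cons_val_zero, Matrix.cons_val_one,
    Matrix.cons_val_fin_one]
  linear_combination ((2 * Real.cos (Real.pi / m) * Real.sin h +
    (s - t) * Real.cos h) ^ 2 +
      (s + t - 2 * Real.sin (Real.pi / m)) ^ 2 * Real.sin h ^ 2) * Real.sin_sq_add_cos_sq g

variable [NeZero m]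

lemma vert_natCast (j : ℕ) : vert m (j : ZMod m) = polyVertex m j := by
  obtain ⟨n, hn⟩ := angle_mod (NeZero.ne m) j 0
  simp only [add_zero] at hn
  rw [vert, polyVertex, polyVertex, ZMod.val_natCast, hn, Real.cos_add_int_mul_two_pi,
    Real.sin_add_int_mul_two_pi]

lemma sideAngle_natCast (j : ℕ) : ∃ n : ℤ, sideAngle m (j : ZMod m) + n * (2 * Real.pi) =
    2 * Real.pi / m * ((j : ℝ) - 1) + Real.pi / m := by
  obtain ⟨n, hn⟩ := angle_mod (NeZero.ne m) j (Real.pi / m)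
  exact ⟨n, by rw [hn, sideAngle, ZMod.val_natCast]⟩

lemma vert_succ (z : ZMod m) : vert m (z + 1) =
    Real.cos (Real.pi / m) • sideNormal m z + Real.sin (Real.pi / m) • sideDir m z := by
  have h0 : z + 1 = ((z.val + 1 : ℕ) : ZMod m) := by simp
  have h : 2 * Real.pi / m * (((z.val + 1 : ℕ) : ℝ) - 1) = sideAngle m z + Real.pi / m := by
    rw [sideAngle]; push_cast; ring
  rw [h0, vert_natCast]
  apply plane_ext <;>
  simp only [polyVertex, h, Real.cos_add, Real.sin_add, sideNormal, sideDir, PiLp.add_apply,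
    PiLp.smul_apply, smul_eq_mul, PiLp.toLp_apply, Matrix.cons_val_zero, Matrix.cons_val_one,
    Matrix.cons_val_fin_one] <;> ring

lemma vert_succ_eq (z : ZMod m) :
    vert m (z + 1) = vert m z + (2 * Real.sin (Real.pi / m)) • sideDir m z := by
  rw [vert_succ, vert_eq]
  module

lemma side_pred (z : ZMod m) (s : ℝ) :
    side m (z - 1) (2 * Real.sin (Real.pi / m) - s) = vert m z + s • -(sideDir m (z - 1)) := by
  have := vert_succ_eq (z - 1)
  rw [sub_add_cancel] at this
  rw [side, this]
  module

lemma inner_sideDir_pred (z : ZMod m) : inner ℝ (sideDir m z) (-(sideDir m (z - 1))) =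
    1 - 2 * Real.cos (Real.pi / m) ^ 2 := by
  obtain ⟨w, rfl⟩ : ∃ w, z = w + 1 := ⟨z - 1, by ring⟩
  have h0 : w + 1 = ((w.val + 1 : ℕ) : ZMod m) := by simp
  obtain ⟨n, hn⟩ := sideAngle_natCast (m := m) (w.val + 1)
  rw [← h0] at hn
  have h1 : sideAngle m (w + 1) = sideAngle m w + 2 * (Real.pi / m) - n * (2 * Real.pi) := by
    rw [eq_sub_iff_add_eq, hn, sideAngle]; push_cast; ring
  have h2 : sideAngle m (w + 1) - sideAngle m w = 2 * (Real.pi / m) - n * (2 * Real.pi) := by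
    rw [h1]; ring
  have h3 := Real.cos_sub (sideAngle m (w + 1)) (sideAngle m w)
  rw [h2, Real.cos_sub_int_mul_two_pi, Real.cos_two_mul] at h3
  rw [add_sub_cancel_right, inner_neg_right, PiLp.inner_apply, Fin.sum_univ_two]
  simp [sideDir]
  linarith

/-- Points on two sides that meet at the vertex `z`, in terms of their distances `p` and `q`
from it. -/
lemma norm_side_sub_side_pred_sq (z : ZMod m) (p q : ℝ) :
    ‖side m z p - side m (z - 1) (2 * Real.sin (Real.pi / m) - q)‖ ^ 2 =
      p ^ 2 + q ^ 2 + 2 * p * q * (2 * Real.cos (Real.pi / m) ^ 2 - 1) := by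
  have : side m z p - side m (z - 1) (2 * Real.sin (Real.pi / m) - q) =
      p • sideDir m z - q • -(sideDir m (z - 1)) := by
    rw [side_pred, side]; abel
  rw [this, norm_sub_sq_real, inner_smul_left, inner_smul_right, inner_sideDir_pred, norm_smul,
    norm_smul, norm_neg, norm_sideDir, norm_sideDir]
  simp
  ring

lemma polySide_eq (j : ℕ) (t : ℝ) :
    polySide m j t = side m (j : ZMod m) (t * (2 * Real.sin (Real.pi / m))) := by
  rw [polySide, ← vert_natCast, ← vert_natCast, Nat.cast_add, Nat.cast_one, vert_succ_eq, side]
  module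

lemma polySideLength_eq (hm : 3 ≤ m) : polySideLength m = 2 * Real.sin (Real.pi / m) := by
  have h := vert_succ_eq ((1 : ℕ) : ZMod m)
  have h2 : ((1 : ℕ) : ZMod m) + 1 = ((2 : ℕ) : ZMod m) := by norm_num
  rw [h2, vert_natCast, vert_natCast] at h
  rw [polySideLength, h, dist_eq_norm]
  simp only [sub_add_cancel_left, norm_neg, norm_smul, norm_sideDir, mul_one, Real.norm_eq_abs]
  exact abs_of_pos (by linarith [sin_pos_of_three_le hm])

/-- Sides without a common vertex are at least one side length apart. -/
lemma le_norm_side_sub_side (hm : 3 ≤ m) {z w : ZMod m} (h0 : z ≠ w) (h1 : z ≠ w + 1)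
    (h2 : w ≠ z + 1) {s t : ℝ} (hs : 0 ≤ s) (hs' : s ≤ 2 * Real.sin (Real.pi / m)) (ht : 0 ≤ t)
    (ht' : t ≤ 2 * Real.sin (Real.pi / m)) :
    2 * Real.sin (Real.pi / m) ≤ ‖side m z s - side m w t‖ := by
  wlog hlt : w.val < z.val generalizing z w s t
  · rw [norm_sub_rev]
    refine this h0.symm h2 h1 ht ht' hs hs' (lt_of_le_of_ne (not_lt.1 hlt) fun h => h0 ?_)
    exact ZMod.val_injective m h
  obtain ⟨d, hd⟩ : ∃ d, z.val = w.val + d := ⟨z.val - w.val, by omega⟩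
  have hd2 : 2 ≤ d := by
    by_contra hcon
    have : d = 1 := by omega
    apply h1
    rw [← ZMod.natCast_zmod_val z, hd, this]
    simp
  have hzm := z.val_lt
  have hdm : d + 2 ≤ m := by
    by_contra hcon
    apply h2
    have hw0 : w.val = 0 := by omega
    have hz1 : z.val + 1 = m := by omega
    have hw' : w = 0 := (ZMod.val_eq_zero w).1 hw0
    rw [hw', ← ZMod.natCast_zmod_val z]
    have : ((z.val + 1 : ℕ) : ZMod m) = 0 := by rw [hz1]; simp
    push_cast at this
    exact this.symm
  have hm0 : (0 : ℝ) < m := by exact_mod_cast (by omega : 0 < m)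
  set θ := Real.pi / m with hθ
  have hθ0 : 0 < θ := div_pos Real.pi_pos hm0
  have hpi : θ * m = Real.pi := by rw [hθ]; field_simp
  have hdc : (z.val : ℝ) - w.val = d := by rw [hd]; push_cast; ring
  have hd2' : (2 : ℝ) ≤ d := by exact_mod_cast hd2
  have hdm' : (d : ℝ) + 2 ≤ m := by exact_mod_cast hdm
  have hs0 := sin_pos_of_three_le hm
  refine le_of_sq_le_sq ?_ (norm_nonneg _)
  rw [norm_side_sub_side_sq, hdc, ← hθ]
  rw [← hθ] at hs0
  set h := θ * d with hh
  have hlo : 2 * θ ≤ h := by rw [hh]; nlinarith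
  have hhi : h ≤ Real.pi - 2 * θ := by rw [hh, ← hpi]; nlinarith
  have hP : 2 * Real.sin θ ≤ 2 * Real.cos θ * Real.sin h + (s - t) * Real.cos h := by
    rcases le_total h (Real.pi / 2) with hc | hc
    · have hcos : 0 ≤ Real.cos h := Real.cos_nonneg_of_mem_Icc ⟨by linarith, hc⟩
      have := Real.sin_le_sin_of_le_of_le_pi_div_two (x := θ) (y := h - θ) (by linarith)
        (by linarith) (by linarith)
      rw [Real.sin_sub] at this
      nlinarith
    · have hcos : Real.cos h ≤ 0 := Real.cos_nonpos_of_pi_div_two_le_of_le hc (by linarith)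
      have := Real.sin_le_sin_of_le_of_le_pi_div_two (x := θ) (y := Real.pi - (h + θ))
        (by linarith) (by linarith) (by linarith)
      rw [Real.sin_pi_sub, Real.sin_add] at this
      nlinarith
  have := pow_le_pow_left₀ (by linarith) hP 2
  nlinarith [mul_nonneg (sq_nonneg (s + t - 2 * Real.sin θ)) (sq_nonneg (Real.sin h))]

end Polygon

/-! ### The radii of the optimal configuration -/

section Radii

/-- The numbers that describe the optimal configuration: each of the `k - 1` centres on a side
captures a segment of length `2 ρ`, a centre in a corner captures the length `r` of each of the
two sides, and `ρ` is the distance from every centre to the far ends of its segments. The ratio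
`κ = ρ / r` is such that two segments of length `w / 2` at a vertex have second moment
`κ² w³ / 12`, as against `w³ / 12` for one segment of length `w`. -/
structure Radii (m k : ℕ) (κ r ρ : ℝ) : Prop where
  three_le : 3 ≤ m
  two_le : 2 ≤ k
  κ_pos : 0 < κ
  κ_sq : κ ^ 2 = (3 * Real.cos (Real.pi / m) ^ 2 + 1) / 4
  r_pos : 0 < r
  ρ_eq : ρ = κ * r
  length_eq : 2 * Real.sin (Real.pi / m) = 2 * r + 2 * ρ * (k - 1)

namespace Radii

variable {m k : ℕ} {κ r ρ : ℝ}

lemma half_le_cos (h : Radii m k κ r ρ) : 1 / 2 ≤ Real.cos (Real.pi / m) := by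
  have h3 : (3 : ℝ) ≤ m := by exact_mod_cast h.three_le
  rw [← Real.cos_pi_div_three]
  apply Real.cos_le_cos_of_nonneg_of_le_pi
  · exact div_nonneg Real.pi_pos.le (by linarith)
  · linarith [Real.pi_pos]
  · exact div_le_div_of_nonneg_left Real.pi_pos.le (by norm_num) h3

lemma sin_pos (h : Radii m k κ r ρ) : 0 < Real.sin (Real.pi / m) := sin_pos_of_three_le h.three_le

lemma cos_lt_one (h : Radii m k κ r ρ) : Real.cos (Real.pi / m) < 1 := by
  nlinarith [h.sin_pos, Real.sin_sq_add_cos_sq (Real.pi / m), h.half_le_cos,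
    Real.cos_le_one (Real.pi / m)]

lemma ρ_pos (h : Radii m k κ r ρ) : 0 < ρ := by rw [h.ρ_eq]; exact mul_pos h.κ_pos h.r_pos

lemma κ_lt_one (h : Radii m k κ r ρ) : κ < 1 := by
  nlinarith [h.κ_sq, h.κ_pos, h.cos_lt_one, h.half_le_cos]

lemma ρ_lt_r (h : Radii m k κ r ρ) : ρ < r := by
  rw [h.ρ_eq]; exact mul_lt_of_lt_one_left h.r_pos h.κ_lt_one

lemma add_le_sin (h : Radii m k κ r ρ) : r + ρ ≤ Real.sin (Real.pi / m) := by
  have hk : (2 : ℝ) ≤ k := by exact_mod_cast h.two_le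
  nlinarith [h.length_eq, h.ρ_pos]

lemma two_mul_ρ_lt (h : Radii m k κ r ρ) : 2 * ρ < Real.sin (Real.pi / m) := by
  linarith [h.add_le_sin, h.ρ_lt_r]

lemma cos_eq_or (hm : 3 ≤ m) :
    Real.cos (Real.pi / m) = 1 / 2 ∨ 1 / 2 ≤ Real.cos (Real.pi / m) ^ 2 := by
  rcases hm.eq_or_lt with rfl | hm
  · left; push_cast; exact Real.cos_pi_div_three
  · right
    have h4 : (4 : ℝ) ≤ m := by exact_mod_cast hm
    have h1 : Real.cos (Real.pi / 4) ≤ Real.cos (Real.pi / m) := by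
      apply Real.cos_le_cos_of_nonneg_of_le_pi
      · exact div_nonneg Real.pi_pos.le (by linarith)
      · linarith [Real.pi_pos]
      · exact div_le_div_of_nonneg_left Real.pi_pos.le (by norm_num) h4
    have h2 : Real.cos (Real.pi / 4) ^ 2 = 1 / 2 := by
      rw [Real.cos_pi_div_four, div_pow, Real.sq_sqrt] <;> norm_num
    rw [← h2]
    exact pow_le_pow_left₀ (Real.cos_nonneg_of_mem_Icc ⟨by linarith [Real.pi_pos],
      by linarith [Real.pi_pos]⟩) h1 2

/-- A point at least half a side away from a vertex has distance at least `2 ρ` from the other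
side at this vertex. -/
lemma four_mul_sq_le (h : Radii m k κ r ρ) {p q : ℝ} (hp : Real.sin (Real.pi / m) ≤ p)
    (hq : 0 ≤ q) :
    (2 * ρ) ^ 2 ≤ p ^ 2 + q ^ 2 + 2 * p * q * (2 * Real.cos (Real.pi / m) ^ 2 - 1) := by
  have hp0 := h.sin_pos.trans_le hp
  rcases cos_eq_or h.three_le with hc | hc
  · have hκ : κ ^ 2 = 7 / 16 := by rw [h.κ_sq, hc]; norm_num
    -- `κ / (1 + κ) ≤ √3 / 4` for an equilateral triangle
    have hκ1 : κ < 0.67 := by nlinarith [h.κ_pos]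
    have h1 : 2 * ρ ≤ 0.85 * p := by
      have h2 := h.add_le_sin
      have h3 : ρ ≤ 0.67 * r := by rw [h.ρ_eq]; nlinarith [h.r_pos]
      linarith
    rw [hc]
    nlinarith [sq_nonneg (p - 2 * q), h.ρ_pos]
  · have h1 := h.two_mul_ρ_lt
    have h2 : 0 ≤ 2 * p * q * (2 * Real.cos (Real.pi / m) ^ 2 - 1) :=
      mul_nonneg (by positivity) (by linarith)
    nlinarith [h.ρ_pos, sq_nonneg q]

lemma sq_lt_of_two_mul_le (h : Radii m k κ r ρ) {p q : ℝ} (hp : 2 * ρ ≤ p) (hq : 0 ≤ q) :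
    ρ ^ 2 < p ^ 2 + q ^ 2 + 2 * p * q * (2 * Real.cos (Real.pi / m) ^ 2 - 1) := by
  have h0 := h.ρ_pos
  have h1 : 1 / 4 ≤ Real.cos (Real.pi / m) ^ 2 := by nlinarith [h.half_le_cos]
  have h2 : 0 ≤ p * q * (4 * Real.cos (Real.pi / m) ^ 2 - 1) :=
    mul_nonneg (mul_nonneg (by linarith) hq) (by linarith)
  nlinarith [sq_nonneg (p - 2 * q)]

variable [NeZero m]

lemma le_norm_side_pred (h : Radii m k κ r ρ) (z : ZMod m) {s t : ℝ}
    (hs : Real.sin (Real.pi / m) ≤ s) (ht : t ≤ 2 * Real.sin (Real.pi / m)) :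
    2 * ρ ≤ ‖side m z s - side m (z - 1) t‖ := by
  refine le_of_sq_le_sq ?_ (norm_nonneg _)
  have := norm_side_sub_side_pred_sq z s (2 * Real.sin (Real.pi / m) - t)
  rw [sub_sub_cancel] at this
  rw [this]
  exact h.four_mul_sq_le hs (by linarith)

lemma le_norm_side_succ (h : Radii m k κ r ρ) (z : ZMod m) {s t : ℝ}
    (hs : s ≤ Real.sin (Real.pi / m)) (ht : 0 ≤ t) :
    2 * ρ ≤ ‖side m z s - side m (z + 1) t‖ := by
  refine le_of_sq_le_sq ?_ (norm_nonneg _)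
  have := norm_side_sub_side_pred_sq (z + 1) t (2 * Real.sin (Real.pi / m) - s)
  rw [sub_sub_cancel, add_sub_cancel_right, norm_sub_rev] at this
  rw [this]
  have h2 := h.four_mul_sq_le (p := 2 * Real.sin (Real.pi / m) - s) (by linarith) ht
  linarith

lemma two_mul_ρ_le_norm (h : Radii m k κ r ρ) {z w : ZMod m} (h0 : z ≠ w) (h1 : z ≠ w + 1)
    (h2 : w ≠ z + 1) {s t : ℝ} (hs : 0 ≤ s) (hs' : s ≤ 2 * Real.sin (Real.pi / m)) (ht : 0 ≤ t)
    (ht' : t ≤ 2 * Real.sin (Real.pi / m)) : 2 * ρ ≤ ‖side m z s - side m w t‖ := by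
  linarith [le_norm_side_sub_side h.three_le h0 h1 h2 hs hs' ht ht', h.two_mul_ρ_lt, h.sin_pos]

/-- A point in the first half of a side is at least `2 ρ` away from all sides that do not contain
the initial vertex of this side. -/
lemma le_norm_of_le (h : Radii m k κ r ρ) {z w : ZMod m} (h0 : w ≠ z) (h1 : w ≠ z - 1)
    {s t : ℝ} (hs : 0 ≤ s) (hs' : s ≤ Real.sin (Real.pi / m)) (ht : 0 ≤ t)
    (ht' : t ≤ 2 * Real.sin (Real.pi / m)) : 2 * ρ ≤ ‖side m z s - side m w t‖ := by
  by_cases h2 : w = z + 1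
  · rw [h2]; exact h.le_norm_side_succ z hs' ht
  · exact h.two_mul_ρ_le_norm h0.symm (fun h3 => h1 (by rw [h3]; ring)) h2 hs
      (by linarith [h.sin_pos]) ht ht'

/-- A point in the second half of a side is at least `2 ρ` away from all sides that do not contain
the final vertex of this side. -/
lemma le_norm_of_ge (h : Radii m k κ r ρ) {z w : ZMod m} (h0 : w ≠ z) (h1 : w ≠ z + 1)
    {s t : ℝ} (hs : Real.sin (Real.pi / m) ≤ s) (hs' : s ≤ 2 * Real.sin (Real.pi / m))
    (ht : 0 ≤ t) (ht' : t ≤ 2 * Real.sin (Real.pi / m)) :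
    2 * ρ ≤ ‖side m z s - side m w t‖ := by
  by_cases h2 : w = z - 1
  · rw [h2]; exact h.le_norm_side_pred z hs ht'
  · exact h.two_mul_ρ_le_norm h0.symm (fun h3 => h2 (by rw [h3]; ring)) h1
      (by linarith [h.sin_pos]) hs' ht ht'

/-- The part of the polygon within distance `ρ` of a point `a` lies on the two sides at one
vertex. -/
lemma exists_vertex (h : Radii m k κ r ρ) (a : Plane) : ∃ z : ZMod m, ∀ w s, 0 ≤ s →
    s ≤ 2 * Real.sin (Real.pi / m) → ‖side m w s - a‖ < ρ → w = z ∨ w = z - 1 := by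
  by_cases hex : ∃ z s, 0 ≤ s ∧ s ≤ 2 * Real.sin (Real.pi / m) ∧ ‖side m z s - a‖ < ρ
  · obtain ⟨z, s, hs, hs', hz⟩ := hex
    have hd : ∀ w t, ‖side m w t - a‖ < ρ → ‖side m z s - side m w t‖ < 2 * ρ := by
      intro w t hw
      have := norm_sub_le_norm_sub_add_norm_sub (side m z s) a (side m w t)
      rw [norm_sub_rev a] at this
      linarith
    rcases le_total s (Real.sin (Real.pi / m)) with hc | hc
    · refine ⟨z, fun w t ht ht' hw => ?_⟩
      by_contra hcon
      push Not at hcon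
      linarith [h.le_norm_of_le hcon.1 hcon.2 hs hc ht ht', hd w t hw]
    · refine ⟨z + 1, fun w t ht ht' hw => ?_⟩
      by_contra hcon
      push Not at hcon
      rw [add_sub_cancel_right] at hcon
      linarith [h.le_norm_of_ge hcon.2 hcon.1 hc hs' ht ht', hd w t hw]
  · exact ⟨0, fun w s hs hs' hw => absurd ⟨w, s, hs, hs', hw⟩ hex⟩

/-- A point of the side `z` that is not close to the vertex `z` has distance more than `ρ` from
the side `z - 1`. -/
lemma lt_norm_side_pred (h : Radii m k κ r ρ) (z : ZMod m) {s t : ℝ}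
    (hs : r + ρ ≤ s) (ht : t ≤ 2 * Real.sin (Real.pi / m)) :
    ρ < ‖side m z s - side m (z - 1) t‖ := by
  refine lt_of_pow_lt_pow_left₀ 2 (norm_nonneg _) ?_
  have := norm_side_sub_side_pred_sq z s (2 * Real.sin (Real.pi / m) - t)
  rw [sub_sub_cancel] at this
  rw [this]
  exact h.sq_lt_of_two_mul_le (by linarith [h.ρ_lt_r]) (by linarith)

lemma lt_norm_side_succ (h : Radii m k κ r ρ) (z : ZMod m) {s t : ℝ}
    (hs : s ≤ 2 * Real.sin (Real.pi / m) - (r + ρ)) (ht : 0 ≤ t) :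
    ρ < ‖side m z s - side m (z + 1) t‖ := by
  refine lt_of_pow_lt_pow_left₀ 2 (norm_nonneg _) ?_
  have := norm_side_sub_side_pred_sq (z + 1) t (2 * Real.sin (Real.pi / m) - s)
  rw [sub_sub_cancel, add_sub_cancel_right, norm_sub_rev] at this
  rw [this]
  have h2 := h.sq_lt_of_two_mul_le (p := 2 * Real.sin (Real.pi / m) - s)
    (by linarith [h.ρ_lt_r]) ht
  linarith

/-- A point of the side `z` that is not close to the two ends of this side has distance more
than `ρ` from all other sides. -/
lemma lt_norm_side (h : Radii m k κ r ρ) {z w : ZMod m} (hwz : w ≠ z) {s t : ℝ}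
    (hs : r + ρ ≤ s) (hs' : s ≤ 2 * Real.sin (Real.pi / m) - (r + ρ)) (ht : 0 ≤ t)
    (ht' : t ≤ 2 * Real.sin (Real.pi / m)) : ρ < ‖side m w t - side m z s‖ := by
  have h0 := h.ρ_pos
  have hr := h.r_pos
  rw [norm_sub_rev]
  by_cases h1 : w = z - 1
  · rw [h1]; exact h.lt_norm_side_pred z hs ht'
  by_cases h2 : w = z + 1
  · rw [h2]; exact h.lt_norm_side_succ z hs' ht
  linarith [h.two_mul_ρ_le_norm hwz.symm (fun h3 => h1 (by rw [h3]; ring)) h2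
    (s := s) (t := t) (by linarith) (by linarith) ht ht']

end Radii

/-- The centre in the corner at the vertex `z`. -/
noncomputable def corner (m : ℕ) (r : ℝ) (z : ZMod m) : Plane :=
  vert m z + (r / 4) • (sideDir m z + -(sideDir m (z - 1)))

namespace Radii

variable {m k : ℕ} {κ r ρ : ℝ}

lemma corner_factor_pos (h : Radii m k κ r ρ) {s : ℝ} (hs : 0 ≤ s) :
    0 < s + r * Real.cos (Real.pi / m) ^ 2 := by
  have := h.half_le_cos
  have := h.r_pos
  positivity

lemma sq_add_mul_le_iff {ρ x y : ℝ} (hy : 0 < y) : ρ ^ 2 + x * y ≤ ρ ^ 2 ↔ x ≤ 0 := by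
  constructor
  · intro h; by_contra hx; nlinarith [mul_pos (not_le.1 hx) hy]
  · intro h; nlinarith

variable [NeZero m]

lemma norm_side_sub_corner_sq (h : Radii m k κ r ρ) (z : ZMod m) (s : ℝ) :
    ‖side m z s - corner m r z‖ ^ 2 =
      ρ ^ 2 + (s - r) * (s + r * Real.cos (Real.pi / m) ^ 2) := by
  rw [side, corner, norm_sub_cornerPoint_sq _ (norm_sideDir z)
    (by rw [norm_neg, norm_sideDir]) (inner_sideDir_pred z), ← h.κ_sq, h.ρ_eq]
  ring

lemma norm_side_pred_sub_corner_sq (h : Radii m k κ r ρ) (z : ZMod m) (s : ℝ) :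
    ‖side m (z - 1) (2 * Real.sin (Real.pi / m) - s) - corner m r z‖ ^ 2 =
      ρ ^ 2 + (s - r) * (s + r * Real.cos (Real.pi / m) ^ 2) := by
  rw [side_pred, corner, add_comm (sideDir m z), norm_sub_cornerPoint_sq _
    (by rw [norm_neg, norm_sideDir]) (norm_sideDir z)
    (by rw [real_inner_comm]; exact inner_sideDir_pred z), ← h.κ_sq, h.ρ_eq]
  ring

lemma norm_side_sub_corner_le_iff (h : Radii m k κ r ρ) (z : ZMod m) {s : ℝ} (hs : 0 ≤ s) :
    ‖side m z s - corner m r z‖ ≤ ρ ↔ s ≤ r := by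
  rw [← pow_le_pow_iff_left₀ (norm_nonneg _) h.ρ_pos.le two_ne_zero, h.norm_side_sub_corner_sq,
    sq_add_mul_le_iff (h.corner_factor_pos hs), sub_nonpos]

lemma norm_side_sub_corner_lt_iff (h : Radii m k κ r ρ) (z : ZMod m) {s : ℝ} (hs : 0 ≤ s) :
    ‖side m z s - corner m r z‖ < ρ ↔ s < r := by
  have h1 := h.corner_factor_pos hs
  rw [← pow_lt_pow_iff_left₀ (norm_nonneg _) h.ρ_pos.le two_ne_zero, h.norm_side_sub_corner_sq]
  constructor
  · intro h2; by_contra hx; nlinarith [mul_nonneg (sub_nonneg.2 (not_lt.1 hx)) h1.le]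
  · intro h2; nlinarith

lemma norm_side_pred_sub_corner_le_iff (h : Radii m k κ r ρ) (z : ZMod m) {s : ℝ}
    (hs : s ≤ 2 * Real.sin (Real.pi / m)) :
    ‖side m (z - 1) s - corner m r z‖ ≤ ρ ↔ 2 * Real.sin (Real.pi / m) - r ≤ s := by
  have h1 := h.norm_side_pred_sub_corner_sq z (2 * Real.sin (Real.pi / m) - s)
  rw [sub_sub_cancel] at h1
  rw [← pow_le_pow_iff_left₀ (norm_nonneg _) h.ρ_pos.le two_ne_zero, h1,
    sq_add_mul_le_iff (h.corner_factor_pos (by linarith)), sub_nonpos, sub_le_comm]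

lemma norm_side_pred_sub_corner_lt_iff (h : Radii m k κ r ρ) (z : ZMod m) {s : ℝ}
    (hs : s ≤ 2 * Real.sin (Real.pi / m)) :
    ‖side m (z - 1) s - corner m r z‖ < ρ ↔ 2 * Real.sin (Real.pi / m) - r < s := by
  have h1 := h.norm_side_pred_sub_corner_sq z (2 * Real.sin (Real.pi / m) - s)
  rw [sub_sub_cancel] at h1
  have h2 := h.corner_factor_pos (s := 2 * Real.sin (Real.pi / m) - s) (by linarith)
  rw [← pow_lt_pow_iff_left₀ (norm_nonneg _) h.ρ_pos.le two_ne_zero, h1]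
  constructor
  · intro h3; by_contra hx
    nlinarith [mul_nonneg (by linarith : 0 ≤ 2 * Real.sin (Real.pi / m) - s - r) h2.le]
  · intro h3; nlinarith

/-- A corner centre has distance more than `ρ` from the sides that do not contain its vertex. -/
lemma lt_norm_side_sub_corner (h : Radii m k κ r ρ) {z w : ZMod m} (h0 : w ≠ z)
    (h1 : w ≠ z - 1) {s : ℝ} (hs : 0 ≤ s) (hs' : s ≤ 2 * Real.sin (Real.pi / m)) :
    ρ < ‖side m w s - corner m r z‖ := by
  have h2 := (h.norm_side_sub_corner_lt_iff z le_rfl).2 h.r_pos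
  have h3 := h.le_norm_of_le h0 h1 le_rfl h.sin_pos.le hs hs'
  have := norm_sub_le_norm_sub_add_norm_sub (side m z 0) (corner m r z) (side m w s)
  rw [norm_sub_rev (corner m r z)] at this
  linarith

end Radii

end Radii

/-! ### Integration over the polygon -/

section Integration

/-- The squared distance from `x` to the set `α`. -/
noncomputable def sqDist (α : Finset Plane) (x : Plane) : ℝ := ⨅ a : α, ‖x - a‖ ^ 2

lemma sqDist_le {α : Finset Plane} {a : Plane} (ha : a ∈ α) (x : Plane) :
    sqDist α x ≤ ‖x - a‖ ^ 2 :=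
  ciInf_le (Set.finite_range fun a : α => ‖x - a‖ ^ 2).bddBelow (⟨a, ha⟩ : α)

lemma exists_sqDist_eq {α : Finset Plane} (hα : α.Nonempty) (x : Plane) :
    ∃ a ∈ α, sqDist α x = ‖x - a‖ ^ 2 := by
  have : Nonempty α := hα.to_subtype
  obtain ⟨a, ha⟩ := exists_eq_ciInf_of_finite (f := fun a : α => ‖x - a‖ ^ 2)
  exact ⟨a, a.2, ha.symm⟩

lemma continuous_sqDist {α : Finset Plane} (hα : α.Nonempty) : Continuous (sqDist α) := by
  have : Nonempty α := hα.to_subtype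
  have heq : sqDist α = fun x => (Finset.univ : Finset α).inf' Finset.univ_nonempty
      (fun a => ‖x - (a : Plane)‖ ^ 2) := by
    ext x
    rw [Finset.inf'_univ_eq_ciInf]
    rfl
  rw [heq]
  exact Continuous.finset_inf'_apply _ fun a _ => by fun_prop

lemma continuous_side (m : ℕ) (z : ZMod m) : Continuous (side m z) := by
  unfold side; fun_prop

variable {m : ℕ}

lemma intervalIntegrable_side {f : Plane → ℝ} (hf : Continuous f) (z : ZMod m) (a b : ℝ) :
    IntervalIntegrable (fun s => f (side m z s)) volume a b :=
  (hf.comp (continuous_side m z)).intervalIntegrable _ _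

variable [NeZero m]

/-- The integral of `f` over the boundary of the polygon with respect to arc length. -/
noncomputable def sideSum (m : ℕ) [NeZero m] (f : Plane → ℝ) : ℝ :=
  ∑ z : ZMod m, ∫ s in 0..2 * Real.sin (Real.pi / m), f (side m z s)

lemma sideSum_add {f g : Plane → ℝ} (hf : Continuous f) (hg : Continuous g) :
    sideSum m (fun x => f x + g x) = sideSum m f + sideSum m g := by
  simp only [sideSum]
  rw [← Finset.sum_add_distrib]
  exact Finset.sum_congr rfl fun z _ => intervalIntegral.integral_add
    (intervalIntegrable_side hf z _ _) (intervalIntegrable_side hg z _ _)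

lemma sideSum_finset_sum {f : Plane → Plane → ℝ} (α : Finset Plane)
    (hf : ∀ a, Continuous (f a)) :
    sideSum m (fun x => ∑ a ∈ α, f a x) = ∑ a ∈ α, sideSum m (f a) := by
  simp only [sideSum]
  rw [Finset.sum_comm]
  exact Finset.sum_congr rfl fun z _ => intervalIntegral.integral_finsetSum
    fun a _ => intervalIntegrable_side (hf a) z _ _

lemma sideSum_const (c : ℝ) :
    sideSum m (fun _ => c) = m * (2 * Real.sin (Real.pi / m)) * c := by
  simp [sideSum, ZMod.card, mul_assoc]

lemma sideSum_mono (hm : 3 ≤ m) {f g : Plane → ℝ} (hf : Continuous f) (hg : Continuous g)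
    (hfg : ∀ z : ZMod m, ∀ s, 0 ≤ s → s ≤ 2 * Real.sin (Real.pi / m) →
      f (side m z s) ≤ g (side m z s)) : sideSum m f ≤ sideSum m g := by
  have := sin_pos_of_three_le hm
  exact Finset.sum_le_sum fun z _ => intervalIntegral.integral_mono_on (by linarith)
    (intervalIntegrable_side hf z _ _) (intervalIntegrable_side hg z _ _)
    fun s hs => hfg z s hs.1 hs.2

lemma sideSum_lt (hm : 3 ≤ m) {f g : Plane → ℝ} (hf : Continuous f) (hg : Continuous g)
    (hfg : ∀ z : ZMod m, ∀ s, 0 ≤ s → s ≤ 2 * Real.sin (Real.pi / m) →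
      f (side m z s) ≤ g (side m z s)) {z : ZMod m} {s : ℝ} (hs : 0 ≤ s)
    (hs' : s ≤ 2 * Real.sin (Real.pi / m)) (hlt : f (side m z s) < g (side m z s)) :
    sideSum m f < sideSum m g := by
  have := sin_pos_of_three_le hm
  refine Finset.sum_lt_sum (fun z _ => intervalIntegral.integral_mono_on (by linarith)
    (intervalIntegrable_side hf z _ _) (intervalIntegrable_side hg z _ _)
    fun s hs => hfg z s hs.1 hs.2) ⟨z, Finset.mem_univ _, ?_⟩
  exact intervalIntegral.integral_lt_integral_of_continuousOn_of_le_of_exists_lt (by linarith)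
    (hf.comp (continuous_side m z)).continuousOn (hg.comp (continuous_side m z)).continuousOn
    (fun s hs => hfg z s hs.1.le hs.2) ⟨s, ⟨hs, hs'⟩, hlt⟩

lemma sum_Icc_eq_sum_zmod (g : ZMod m → ℝ) :
    ∑ j ∈ Finset.Icc 1 m, g (j : ZMod m) = ∑ z, g z := by
  have h1 : ∑ j ∈ Finset.Icc 1 m, g (j : ZMod m) =
      ∑ i ∈ Finset.range m, g (((i + 1 : ℕ) : ZMod m)) := by
    rw [Finset.range_eq_Ico, Finset.sum_Ico_add' (fun j : ℕ => g (j : ZMod m)) 0 m 1]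
    rfl
  have h2 : ∑ i ∈ Finset.range m, g (((i + 1 : ℕ) : ZMod m)) = ∑ z : ZMod m, g (z + 1) := by
    refine Finset.sum_bij' (fun i _ => (i : ZMod m)) (fun z _ => z.val) (by simp)
      (fun z _ => Finset.mem_range.2 z.val_lt) (fun i hi => ?_) (by simp) (by simp)
    rw [ZMod.val_natCast, Nat.mod_eq_of_lt (Finset.mem_range.1 hi)]
  rw [h1, h2]
  exact Equiv.sum_comp (Equiv.addRight (1 : ZMod m)) g

lemma continuous_polySide (m j : ℕ) : Continuous (polySide m j) := by
  unfold polySide; fun_prop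

lemma integral_polyUniform (hm : 3 ≤ m) {f : Plane → ℝ} (hf : Continuous f) :
    ∫ x, f x ∂(polyUniform m) = sideSum m f / (m * (2 * Real.sin (Real.pi / m))) := by
  have hs := sin_pos_of_three_le hm
  have hm0 : (0 : ℝ) < m := by exact_mod_cast (by omega : 0 < m)
  have hmap : ∀ j, Integrable f ((volume.restrict (Set.Icc (0 : ℝ) 1)).map (polySide m j)) := by
    intro j
    rw [integrable_map_measure hf.aestronglyMeasurable (continuous_polySide m j).aemeasurable]
    exact (hf.comp (continuous_polySide m j)).integrableOn_Icc
  rw [polyUniform, integral_finsetSum_measure fun j _ =>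
    ((hmap j).smul_measure ENNReal.ofReal_ne_top).smul_measure ENNReal.ofReal_ne_top]
  rw [sideSum, ← sum_Icc_eq_sum_zmod
    fun z => ∫ s in 0..2 * Real.sin (Real.pi / m), f (side m z s), Finset.sum_div]
  refine Finset.sum_congr rfl fun j _ => ?_
  rw [integral_smul_measure, integral_smul_measure, integral_map
    (continuous_polySide m j).aemeasurable hf.aestronglyMeasurable, polySideLength_eq hm,
    ENNReal.toReal_ofReal (by positivity), ENNReal.toReal_ofReal (by positivity),
    integral_Icc_eq_integral_Ioc, ← intervalIntegral.integral_of_le zero_le_one]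
  simp only [polySide_eq]
  rw [intervalIntegral.integral_comp_mul_right (fun s => f (side m j s)) (by positivity)]
  simp only [zero_mul, one_mul, smul_eq_mul]
  field_simp

lemma distortion_eq (hm : 3 ≤ m) {α : Finset Plane} (hα : α.Nonempty) :
    distortion (polyUniform m) α =
      sideSum m (sqDist α) / (m * (2 * Real.sin (Real.pi / m))) :=
  integral_polyUniform hm (continuous_sqDist hα)

/-- Summing over the vertices the mass captured on the two sides at each vertex is the same as
summing over the sides the masses captured on each side from its two ends. -/
lemma sum_cornerMass (ρ : ℝ) (T : ZMod m → Finset Plane) :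
    ∑ z : ZMod m, cornerMass ρ (2 * Real.sin (Real.pi / m)) (vert m z) (sideDir m z)
      (-(sideDir m (z - 1))) (T z) =
    ∑ z : ZMod m, ((∫ s in 0..2 * Real.sin (Real.pi / m), bump ρ (T z) (side m z s)) +
      ∫ s in 0..2 * Real.sin (Real.pi / m), bump ρ (T (z + 1)) (side m z s)) := by
  have key : ∀ z : ZMod m, ∫ s in 0..2 * Real.sin (Real.pi / m),
      bump ρ (T z) (vert m z + s • -(sideDir m (z - 1))) =
      ∫ s in 0..2 * Real.sin (Real.pi / m), bump ρ (T z) (side m (z - 1) s) := by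
    intro z
    simp only [← side_pred]
    rw [intervalIntegral.integral_comp_sub_left (fun s => bump ρ (T z) (side m (z - 1) s))]
    simp
  simp only [cornerMass, key]
  rw [Finset.sum_add_distrib, Finset.sum_add_distrib]
  refine congrArg₂ (· + ·) rfl ?_
  rw [← Equiv.sum_comp (Equiv.addRight (1 : ZMod m))]
  simp

end Integration

/-! ### The lower bound for the distortion -/

section LowerBound

namespace Radii

variable {m k : ℕ} {κ r ρ : ℝ}

lemma ρ_mul_inv (h : Radii m k κ r ρ) : ρ * (1 / κ) = r := by
  have := h.κ_pos.ne'
  rw [h.ρ_eq]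
  field_simp

lemma one_lt_inv (h : Radii m k κ r ρ) : 1 < 1 / κ := by
  rw [lt_div_iff₀ h.κ_pos]; linarith [h.κ_lt_one]

lemma total_eq (h : Radii m k κ r ρ) :
    4 / 3 * ρ ^ 3 * ((m * k : ℕ) + m * (1 / κ - 1)) =
      m * (2 * Real.sin (Real.pi / m)) * (2 / 3 * ρ ^ 2) := by
  rw [h.length_eq, ← h.ρ_mul_inv]
  push_cast
  ring

variable [NeZero m]

/-- `cornerMass_le` at a vertex of the polygon. -/
lemma cornerMass_vert (h : Radii m k κ r ρ) (z : ZMod m) (T : Finset Plane) :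
    cornerMass ρ (2 * Real.sin (Real.pi / m)) (vert m z) (sideDir m z)
      (-(sideDir m (z - 1))) T ≤ 4 / 3 * ρ ^ 3 * (T.card + (1 / κ - 1)) ∧
    (cornerMass ρ (2 * Real.sin (Real.pi / m)) (vert m z) (sideDir m z)
      (-(sideDir m (z - 1))) T = 4 / 3 * ρ ^ 3 * (T.card + (1 / κ - 1)) →
      corner m r z ∈ T ∧ ∀ a ∈ T, a ≠ corner m r z → ∃ t, r + ρ ≤ t ∧
        t ≤ 2 * Real.sin (Real.pi / m) - ρ ∧
        (a = side m z t ∨ a = side m (z - 1) (2 * Real.sin (Real.pi / m) - t))) := by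
  rcases Nat.eq_zero_or_pos T.card with h0 | h0
  · have hT : T = ∅ := Finset.card_eq_zero.1 h0
    have h1 : 0 < 4 / 3 * ρ ^ 3 * (1 / κ - 1) :=
      mul_pos (by have := h.ρ_pos; positivity) (by linarith [h.one_lt_inv])
    have h2 : cornerMass ρ (2 * Real.sin (Real.pi / m)) (vert m z) (sideDir m z)
        (-(sideDir m (z - 1))) T = 0 := by
      simp [hT, cornerMass, bump_empty]
    rw [h2, h0]
    simp only [Nat.cast_zero, zero_add]
    exact ⟨h1.le, fun h3 => absurd h3 h1.ne⟩
  · obtain ⟨n, hn⟩ : ∃ n, T.card = n + 1 := ⟨T.card - 1, by omega⟩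
    have := cornerMass_le h.ρ_pos (by linarith [h.sin_pos] : 0 ≤ 2 * Real.sin (Real.pi / m))
      h.half_le_cos h.cos_lt_one h.κ_pos h.κ_sq h.ρ_eq (vert m z) (norm_sideDir z)
      (by rw [norm_neg, norm_sideDir]) (inner_sideDir_pred z) n T hn
    have e : (4 / 3 * ρ ^ 3 * (T.card + (1 / κ - 1))) = 4 / 3 * ρ ^ 3 * (n + 1 / κ) := by
      rw [hn]; push_cast; ring
    rw [e]
    simp only [side_pred]
    exact this

/-- If the part of the polygon within distance `ρ` of each centre `a` lies on the two sides at the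
vertex `J a`, then the captured mass is at most the sum of the masses captured in the corners. -/
lemma sideSum_bump_le_sum (h : Radii m k κ r ρ) (α : Finset Plane) (J : Plane → ZMod m)
    (hJ : ∀ a ∈ α, ∀ w s, 0 ≤ s → s ≤ 2 * Real.sin (Real.pi / m) → ‖side m w s - a‖ < ρ →
      w = J a ∨ w = J a - 1) :
    sideSum m (bump ρ α) ≤ ∑ z : ZMod m, cornerMass ρ (2 * Real.sin (Real.pi / m))
      (vert m z) (sideDir m z) (-(sideDir m (z - 1))) (α.filter (J · = z)) := by
  rw [sum_cornerMass]
  refine Finset.sum_le_sum fun z _ => ?_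
  rw [← intervalIntegral.integral_add (intervalIntegrable_side (continuous_bump _ _) z _ _)
    (intervalIntegrable_side (continuous_bump _ _) z _ _)]
  refine intervalIntegral.integral_mono_on (by linarith [h.sin_pos])
    (intervalIntegrable_side (continuous_bump _ _) z _ _)
    ((intervalIntegrable_side (continuous_bump _ _) z _ _).add
    (intervalIntegrable_side (continuous_bump _ _) z _ _)) fun s hs => ?_
  have n1 := bump_nonneg ρ (α.filter (J · = z)) (side m z s)
  have n2 := bump_nonneg ρ (α.filter (J · = z + 1)) (side m z s)
  refine bump_le (add_nonneg n1 n2) fun a ha => ?_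
  by_cases hlt : ‖side m z s - a‖ < ρ
  · rcases hJ a ha z s hs.1 hs.2 hlt with h1 | h1
    · have := le_bump ρ (T := α.filter (J · = z)) (Finset.mem_filter.2 ⟨ha, h1.symm⟩)
        (side m z s)
      linarith
    · have := le_bump ρ (T := α.filter (J · = z + 1))
        (Finset.mem_filter.2 ⟨ha, by rw [h1]; ring⟩) (side m z s)
      linarith
  · nlinarith [h.ρ_pos]

/-- All centres together capture at most the mass that the optimal configuration captures. The
centres are distributed to the vertices of the polygon by `exists_vertex`. -/
lemma sideSum_bump_le (h : Radii m k κ r ρ) (α : Finset Plane) :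
    sideSum m (bump ρ α) ≤ 4 / 3 * ρ ^ 3 * (α.card + m * (1 / κ - 1)) ∧
    (sideSum m (bump ρ α) = 4 / 3 * ρ ^ 3 * (α.card + m * (1 / κ - 1)) →
      (∀ z, corner m r z ∈ α) ∧ ∀ a ∈ α, ∃ z, (∀ w s, 0 ≤ s →
        s ≤ 2 * Real.sin (Real.pi / m) → ‖side m w s - a‖ < ρ → w = z ∨ w = z - 1) ∧
        (a = corner m r z ∨ ∃ t, r + ρ ≤ t ∧
        t ≤ 2 * Real.sin (Real.pi / m) - ρ ∧
        (a = side m z t ∨ a = side m (z - 1) (2 * Real.sin (Real.pi / m) - t)))) := by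
  classical
  choose J hJ using h.exists_vertex (m := m)
  set T : ZMod m → Finset Plane := fun z => α.filter (J · = z) with hT
  have hle := h.sideSum_bump_le_sum α J fun a _ => hJ a
  have hcard : ∑ z : ZMod m, 4 / 3 * ρ ^ 3 * (((T z).card : ℝ) + (1 / κ - 1)) =
      4 / 3 * ρ ^ 3 * (α.card + m * (1 / κ - 1)) := by
    rw [← Finset.mul_sum, Finset.sum_add_distrib, ← Nat.cast_sum,
      ← Finset.card_eq_sum_card_fiberwise (f := J) (t := Finset.univ) (by simp)]
    rw [Finset.sum_const, Finset.card_univ, ZMod.card, nsmul_eq_mul]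
  rw [← hcard]
  refine ⟨hle.trans (Finset.sum_le_sum fun z _ => (h.cornerMass_vert z (T z)).1), fun heq => ?_⟩
  have hall := (Finset.sum_eq_sum_iff_of_le fun z _ => (h.cornerMass_vert z (T z)).1).1
    (le_antisymm (Finset.sum_le_sum fun z _ => (h.cornerMass_vert z (T z)).1)
      (heq.symm.le.trans hle))
  have hst := fun z => (h.cornerMass_vert z (T z)).2 (hall z (Finset.mem_univ _))
  refine ⟨fun z => (Finset.mem_filter.1 (hst z).1).1, fun a ha => ⟨J a, hJ a, ?_⟩⟩
  rw [or_iff_not_imp_left]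
  exact (hst (J a)).2 a (Finset.mem_filter.2 ⟨ha, rfl⟩)

lemma sub_bump_le_sqDist {ρ : ℝ} {α : Finset Plane} (hα : α.Nonempty) (x : Plane) :
    ρ ^ 2 ≤ sqDist α x + bump ρ α x := by
  obtain ⟨a, ha, h⟩ := exists_sqDist_eq hα x
  linarith [le_bump ρ ha x]

/-- Every set of at most `m k` centres has distortion at least `ρ² / 3`. In case of equality there
are exactly `m k` centres, they capture the maximal mass, and every point of the polygon is within
distance `ρ` of a centre. -/
lemma le_distortion (h : Radii m k κ r ρ) {α : Finset Plane} (hα : α.Nonempty)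
    (hcard : α.card ≤ m * k) :
    ρ ^ 2 / 3 ≤ distortion (polyUniform m) α ∧
    (distortion (polyUniform m) α = ρ ^ 2 / 3 → α.card = m * k ∧
      sideSum m (bump ρ α) = 4 / 3 * ρ ^ 3 * (α.card + m * (1 / κ - 1)) ∧
      ∀ z : ZMod m, ∀ s, 0 ≤ s → s ≤ 2 * Real.sin (Real.pi / m) →
        ∃ a ∈ α, ‖side m z s - a‖ ≤ ρ) := by
  have hm0 : (0 : ℝ) < m := by exact_mod_cast (by have := h.three_le; omega : 0 < m)
  have hL : 0 < m * (2 * Real.sin (Real.pi / m)) := by have := h.sin_pos; positivity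
  have hc1 := continuous_sqDist hα
  have hc2 := continuous_bump ρ α
  have h1 : sideSum m (fun _ => ρ ^ 2) ≤ sideSum m (fun x => sqDist α x + bump ρ α x) :=
    sideSum_mono h.three_le continuous_const (hc1.add hc2) fun _ _ _ _ =>
      sub_bump_le_sqDist hα _
  have h2 := (h.sideSum_bump_le α).1
  have hM : 0 < 4 / 3 * ρ ^ 3 := by have := h.ρ_pos; positivity
  have h3 : 4 / 3 * ρ ^ 3 * (α.card + m * (1 / κ - 1)) ≤
      4 / 3 * ρ ^ 3 * ((m * k : ℕ) + m * (1 / κ - 1)) := by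
    have : (α.card : ℝ) ≤ (m * k : ℕ) := by exact_mod_cast hcard
    gcongr
  rw [h.total_eq] at h3
  rw [sideSum_const, sideSum_add hc1 hc2] at h1
  rw [distortion_eq h.three_le hα]
  refine ⟨by rw [le_div_iff₀ hL]; linarith, fun heq => ?_⟩
  rw [div_eq_iff hL.ne'] at heq
  have h4 : 4 / 3 * ρ ^ 3 * (α.card + m * (1 / κ - 1)) =
      4 / 3 * ρ ^ 3 * ((m * k : ℕ) + m * (1 / κ - 1)) := by
    rw [h.total_eq]; linarith
  refine ⟨?_, by linarith, fun z s hs hs' => ?_⟩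
  · have := mul_left_cancel₀ hM.ne' h4
    exact_mod_cast add_right_cancel this
  · obtain ⟨a, ha, hax⟩ := exists_sqDist_eq hα (side m z s)
    refine ⟨a, ha, ?_⟩
    by_contra hcon
    have hlt : ρ ^ 2 < sqDist α (side m z s) + bump ρ α (side m z s) := by
      have n := bump_nonneg ρ α (side m z s)
      rw [hax]
      nlinarith [h.ρ_pos]
    have := sideSum_lt h.three_le (f := fun _ => ρ ^ 2)
      (g := fun x => sqDist α x + bump ρ α x) continuous_const (hc1.add hc2)
      (fun _ _ _ _ => sub_bump_le_sqDist hα _) hs hs' hlt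
    rw [sideSum_const, sideSum_add hc1 hc2] at this
    linarith

end Radii

end LowerBound

/-! ### The optimal configuration -/

section Configuration

variable {m : ℕ}

lemma sideDir_succ [NeZero m] (w : ZMod m) : sideDir m (w + 1) =
    Real.cos (2 * (Real.pi / m)) • sideDir m w - Real.sin (2 * (Real.pi / m)) • sideNormal m w := by
  have h0 : w + 1 = ((w.val + 1 : ℕ) : ZMod m) := by simp
  obtain ⟨n, hn⟩ := sideAngle_natCast (m := m) (w.val + 1)
  rw [← h0] at hn
  have h1 : sideAngle m (w + 1) = sideAngle m w + 2 * (Real.pi / m) - n * (2 * Real.pi) := by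
    rw [eq_sub_iff_add_eq, hn, sideAngle]; push_cast; ring
  apply plane_ext <;>
  simp only [sideDir, h1, Real.cos_sub_int_mul_two_pi, Real.sin_sub_int_mul_two_pi, Real.cos_add,
    Real.sin_add, sideNormal, PiLp.sub_apply,
    PiLp.smul_apply, smul_eq_mul, Matrix.cons_val_zero, Matrix.cons_val_one,
    Matrix.cons_val_fin_one] <;> ring

/-- The corner centres lie on the radii of the circumscribed circle. -/
lemma corner_eq_smul [NeZero m] (r : ℝ) (z : ZMod m) :
    corner m r z = (1 - r * Real.sin (Real.pi / m) / 2) • vert m z := by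
  obtain ⟨w, rfl⟩ : ∃ w, z = w + 1 := ⟨z - 1, by ring⟩
  have h1 : (1 : ℝ) = Real.sin (Real.pi / m) ^ 2 + Real.cos (Real.pi / m) ^ 2 :=
    (Real.sin_sq_add_cos_sq _).symm
  have h : sideDir m (w + 1) + -(sideDir m w) = -(2 * Real.sin (Real.pi / m)) • vert m (w + 1) := by
    rw [sideDir_succ, vert_succ, Real.cos_two_mul, Real.sin_two_mul, ← sub_eq_zero]
    have h2 : 2 * Real.cos (Real.pi / m) ^ 2 - 1 = 1 - 2 * Real.sin (Real.pi / m) ^ 2 := by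
      linarith
    rw [h2]
    module
  rw [corner, add_sub_cancel_right, h]
  module

lemma anglePoint_eq [NeZero m] (hm : 3 ≤ m) (r : ℝ) (j : ℕ) :
    anglePoint m r j = corner m r (j : ZMod m) := by
  have hs := (sin_pos_of_three_le hm).ne'
  have hc : Real.cos (2 * Real.pi / m) - 1 = -2 * Real.sin (Real.pi / m) ^ 2 := by
    rw [mul_div_assoc, Real.cos_two_mul, Real.cos_sq']; ring
  rw [corner_eq_smul, vert_natCast, anglePoint]
  split_ifs with h
  · subst h
    apply plane_ext <;> simp [polyVertex]
    ring
  · have e : 2 * Real.pi * ((j : ℝ) - 1) / m = 2 * Real.pi / m * ((j : ℝ) - 1) := by ring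
    apply plane_ext <;>
    simp only [polyVertex, hc, e, PiLp.smul_apply, smul_eq_mul, Matrix.cons_val_zero,
      Matrix.cons_val_one, Matrix.cons_val_fin_one] <;> field_simp <;> ring

namespace Radii

variable {k : ℕ} {κ r ρ : ℝ}

lemma sub_one_pos (h : Radii m k κ r ρ) : (0 : ℝ) < k - 1 := by
  have : (2 : ℝ) ≤ k := by exact_mod_cast h.two_le
  linarith

lemma norm_side_sub_side (z : ZMod m) (s t : ℝ) : ‖side m z s - side m z t‖ = |s - t| := by
  have : side m z s - side m z t = (s - t) • sideDir m z := by rw [side, side]; module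
  rw [this, norm_smul, norm_sideDir, mul_one, Real.norm_eq_abs]

lemma add_eq_length (h : Radii m k κ r ρ) :
    r + 2 * ((k - 1 : ℕ) : ℝ) * ρ = 2 * Real.sin (Real.pi / m) - r := by
  rw [h.length_eq, Nat.cast_sub (by have := h.two_le; omega)]
  push_cast
  ring

lemma integral_corner_segment (h : Radii m k κ r ρ) :
    ∫ s in 0..r, (ρ ^ 2 + (s - r) * (s + r * Real.cos (Real.pi / m) ^ 2)) = r * (ρ ^ 2 / 3) := by
  have hd : ∀ s ∈ Set.uIcc 0 r, HasDerivAt (fun s : ℝ => ρ ^ 2 * s + s ^ 3 / 3 +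
      (r * Real.cos (Real.pi / m) ^ 2 - r) * (s ^ 2 / 2) - r ^ 2 * Real.cos (Real.pi / m) ^ 2 * s)
      (ρ ^ 2 + (s - r) * (s + r * Real.cos (Real.pi / m) ^ 2)) s := by
    intro s _
    have h1 := ((((hasDerivAt_id s).const_mul (ρ ^ 2)).add ((hasDerivAt_pow 3 s).div_const 3)).add
      (((hasDerivAt_pow 2 s).div_const 2).const_mul (r * Real.cos (Real.pi / m) ^ 2 - r))).sub
      ((hasDerivAt_id s).const_mul (r ^ 2 * Real.cos (Real.pi / m) ^ 2))
    refine h1.congr_deriv ?_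
    push_cast
    ring
  rw [intervalIntegral.integral_eq_sub_of_hasDerivAt hd
    (Continuous.intervalIntegrable (by fun_prop) _ _), h.ρ_eq, mul_pow, h.κ_sq]
  ring

lemma integral_tile (a ρ : ℝ) : ∫ s in a..(a + 2 * ρ), (s - (a + ρ)) ^ 2 = 2 * ρ * (ρ ^ 2 / 3) := by
  rw [intervalIntegral.integral_comp_sub_right (fun s => s ^ 2), integral_pow]
  push_cast
  ring

lemma card_polyMeans_le (h : Radii m k κ r ρ) : (polyMeans m k r).card ≤ m * k := by
  classical
  have h1 : ((Finset.Icc 1 m).image (anglePoint m r)).card ≤ m := by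
    simpa using Finset.card_image_le (s := Finset.Icc 1 m) (f := anglePoint m r)
  have h2 : ((Finset.Icc 1 m).biUnion fun j =>
      (Finset.Icc 1 (k - 1)).image fun i => polySide m j (sideParam m k r i)).card ≤
      m * (k - 1) := by
    have := Finset.card_biUnion_le_card_mul (Finset.Icc 1 m)
      (fun j => (Finset.Icc 1 (k - 1)).image fun i => polySide m j (sideParam m k r i)) (k - 1)
      fun _ _ => Finset.card_image_le.trans (by simp)
    simpa using this
  have h3 := Finset.card_union_le ((Finset.Icc 1 m).image (anglePoint m r))
    ((Finset.Icc 1 m).biUnion fun j =>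
      (Finset.Icc 1 (k - 1)).image fun i => polySide m j (sideParam m k r i))
  have h4 : m * k = m + m * (k - 1) := by
    obtain ⟨l, rfl⟩ : ∃ l, k = l + 1 := ⟨k - 1, by have := h.two_le; omega⟩
    simp; ring
  have h5 : (polyMeans m k r).card ≤ _ := h3
  omega

variable [NeZero m]

lemma sideParam_mul (h : Radii m k κ r ρ) (i : ℕ) :
    sideParam m k r i * (2 * Real.sin (Real.pi / m)) = r + (2 * (i : ℝ) - 1) * ρ := by
  have hs := h.sin_pos.ne'
  have hk := h.sub_one_pos.ne'
  rw [sideParam, polySideLength_eq h.three_le]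
  have e : ρ = (2 * Real.sin (Real.pi / m) - 2 * r) / (2 * ((k : ℝ) - 1)) := by
    rw [h.length_eq]; field_simp; ring
  rw [e]
  field_simp

lemma exists_natCast_eq (z : ZMod m) : ∃ j ∈ Finset.Icc 1 m, (j : ZMod m) = z := by
  have hm : 0 < m := NeZero.pos m
  exact ⟨(z - 1).val + 1, Finset.mem_Icc.2 ⟨by omega, (z - 1).val_lt⟩, by simp⟩

lemma mem_polyMeans (h : Radii m k κ r ρ) {a : Plane} : a ∈ polyMeans m k r ↔
    (∃ z : ZMod m, a = corner m r z) ∨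
      ∃ z : ZMod m, ∃ i : ℕ, i < k - 1 ∧ a = side m z (r + (2 * i + 1) * ρ) := by
  simp only [polyMeans, Finset.mem_union, Finset.mem_image, Finset.mem_biUnion,
    anglePoint_eq h.three_le, polySide_eq, h.sideParam_mul]
  refine or_congr ⟨?_, ?_⟩ ⟨?_, ?_⟩
  · rintro ⟨j, -, rfl⟩
    exact ⟨j, rfl⟩
  · rintro ⟨z, rfl⟩
    obtain ⟨j, hj, rfl⟩ := exists_natCast_eq z
    exact ⟨j, hj, rfl⟩
  · rintro ⟨j, -, i, hi, rfl⟩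
    obtain ⟨h1, h2⟩ := Finset.mem_Icc.1 hi
    refine ⟨j, i - 1, by omega, ?_⟩
    rw [Nat.cast_sub h1]
    push_cast
    congr 1
    ring
  · rintro ⟨z, i, hi, rfl⟩
    obtain ⟨j, hj, rfl⟩ := exists_natCast_eq z
    refine ⟨j, hj, i + 1, Finset.mem_Icc.2 ⟨by omega, by omega⟩, ?_⟩
    push_cast
    congr 1
    ring

lemma corner_mem_polyMeans (h : Radii m k κ r ρ) (z : ZMod m) :
    corner m r z ∈ polyMeans m k r := h.mem_polyMeans.2 (Or.inl ⟨z, rfl⟩)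

lemma polyMeans_nonempty (h : Radii m k κ r ρ) : (polyMeans m k r).Nonempty :=
  ⟨_, h.corner_mem_polyMeans 0⟩

lemma integral_sqDist_polyMeans_le (h : Radii m k κ r ρ) (z : ZMod m) :
    ∫ s in 0..2 * Real.sin (Real.pi / m), sqDist (polyMeans m k r) (side m z s) ≤
      2 * Real.sin (Real.pi / m) * (ρ ^ 2 / 3) := by
  set f : ℝ → ℝ := fun s => sqDist (polyMeans m k r) (side m z s) with hf
  have hfc : Continuous f := (continuous_sqDist h.polyMeans_nonempty).comp (continuous_side m z)
  have hi : ∀ a b, IntervalIntegrable f volume a b := fun a b => hfc.intervalIntegrable _ _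
  have e1 : ∫ s in 0..r, f s ≤ r * (ρ ^ 2 / 3) := by
    rw [← h.integral_corner_segment]
    refine intervalIntegral.integral_mono_on h.r_pos.le (hi _ _)
      (Continuous.intervalIntegrable (by fun_prop) _ _) fun s _ => ?_
    rw [← h.norm_side_sub_corner_sq z]
    exact sqDist_le (h.corner_mem_polyMeans z) _
  have e3 : ∫ s in (2 * Real.sin (Real.pi / m) - r)..(2 * Real.sin (Real.pi / m)), f s ≤
      r * (ρ ^ 2 / 3) := by
    have : ∫ s in (2 * Real.sin (Real.pi / m) - r)..(2 * Real.sin (Real.pi / m)), f s =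
        ∫ s in 0..r, f (2 * Real.sin (Real.pi / m) - s) := by
      rw [intervalIntegral.integral_comp_sub_left, sub_zero]
    rw [this, ← h.integral_corner_segment]
    refine intervalIntegral.integral_mono_on h.r_pos.le
      ((hfc.comp (by fun_prop : Continuous fun s => 2 * Real.sin (Real.pi / m) - s)).intervalIntegrable
        _ _)
      (Continuous.intervalIntegrable (by fun_prop) _ _) fun s _ => ?_
    have h1 := h.norm_side_pred_sub_corner_sq (z + 1) s
    rw [add_sub_cancel_right] at h1
    rw [← h1]
    exact sqDist_le (h.corner_mem_polyMeans (z + 1)) _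
  have e2 : ∫ s in r..(2 * Real.sin (Real.pi / m) - r), f s ≤
      2 * ((k - 1 : ℕ) : ℝ) * ρ * (ρ ^ 2 / 3) := by
    have hsum := intervalIntegral.sum_integral_adjacent_intervals (f := f) (μ := volume)
      (a := fun i : ℕ => r + 2 * (i : ℝ) * ρ) (n := k - 1) fun _ _ => hi _ _
    simp only [Nat.cast_zero, mul_zero, zero_mul, add_zero, h.add_eq_length] at hsum
    rw [← hsum]
    have hb : ∀ i ∈ Finset.range (k - 1),
        ∫ s in (r + 2 * (i : ℝ) * ρ)..(r + 2 * ((i + 1 : ℕ) : ℝ) * ρ), f s ≤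
          2 * ρ * (ρ ^ 2 / 3) := by
      intro i hik
      rw [← integral_tile (r + 2 * (i : ℝ) * ρ) ρ]
      have e : r + 2 * ((i + 1 : ℕ) : ℝ) * ρ = r + 2 * (i : ℝ) * ρ + 2 * ρ := by push_cast; ring
      rw [e]
      refine intervalIntegral.integral_mono_on (by linarith [h.ρ_pos]) (hi _ _)
        (Continuous.intervalIntegrable (by fun_prop) _ _) fun s _ => ?_
      have h1 := sqDist_le (h.mem_polyMeans.2 (Or.inr ⟨z, i, Finset.mem_range.1 hik, rfl⟩))
        (side m z s)
      rw [norm_side_sub_side, sq_abs] at h1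
      refine h1.trans (le_of_eq ?_)
      ring
    refine (Finset.sum_le_sum hb).trans (le_of_eq ?_)
    rw [Finset.sum_const, Finset.card_range, nsmul_eq_mul]
    ring
  rw [← intervalIntegral.integral_add_adjacent_intervals (hi 0 r) (hi r _),
    ← intervalIntegral.integral_add_adjacent_intervals
      (hi r (2 * Real.sin (Real.pi / m) - r)) (hi _ _)]
  have e4 := h.add_eq_length
  have e5 : 2 * Real.sin (Real.pi / m) * (ρ ^ 2 / 3) = r * (ρ ^ 2 / 3) +
      (2 * ((k - 1 : ℕ) : ℝ) * ρ * (ρ ^ 2 / 3) + r * (ρ ^ 2 / 3)) := by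
    linear_combination (-(ρ ^ 2 / 3)) * e4
  linarith

lemma distortion_polyMeans (h : Radii m k κ r ρ) :
    distortion (polyUniform m) (polyMeans m k r) = ρ ^ 2 / 3 := by
  have hm0 : (0 : ℝ) < m := by exact_mod_cast (by have := h.three_le; omega : 0 < m)
  have hL : 0 < m * (2 * Real.sin (Real.pi / m)) := by have := h.sin_pos; positivity
  refine le_antisymm ?_ (h.le_distortion h.polyMeans_nonempty h.card_polyMeans_le).1
  rw [distortion_eq h.three_le h.polyMeans_nonempty, div_le_iff₀ hL]
  refine (Finset.sum_le_sum fun z _ => h.integral_sqDist_polyMeans_le z).trans (le_of_eq ?_)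
  rw [Finset.sum_const, Finset.card_univ, ZMod.card, nsmul_eq_mul]
  ring

lemma card_polyMeans (h : Radii m k κ r ρ) : (polyMeans m k r).card = m * k :=
  ((h.le_distortion h.polyMeans_nonempty h.card_polyMeans_le).2 h.distortion_polyMeans).1

lemma quantizationError_eq (h : Radii m k κ r ρ) :
    quantizationError (polyUniform m) (m * k) = ρ ^ 2 / 3 := by
  refine IsLeast.csInf_eq ⟨⟨polyMeans m k r, h.polyMeans_nonempty.card_pos, h.card_polyMeans_le,
    h.distortion_polyMeans.symm⟩, ?_⟩
  rintro v ⟨α, h1, h2, rfl⟩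
  exact (h.le_distortion (Finset.card_pos.1 h1) h2).1

end Radii

end Configuration

/-! ### Uniqueness of the optimal configuration -/

section Uniqueness

/-- One centre captures at most `4/3 ρ³` of a line. -/
lemma integral_bump_singleton_le {E : Type*} [NormedAddCommGroup E] [InnerProductSpace ℝ E]
    {ρ L : ℝ} (hρ : 0 < ρ) (hL : 0 ≤ L) (A a : E) {e : E} (he : ‖e‖ = 1) :
    ∫ s in 0..L, bump ρ {a} (A + s • e) ≤ 4 / 3 * ρ ^ 3 := by
  classical
  obtain ⟨x, q, hx, hq, -, hi, -⟩ := exists_integral_bump_insert hρ.le A a he (T := ∅)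
    (by simp) hL
  obtain ⟨u, rfl⟩ : ∃ u, q = x + u := ⟨q - x, by ring⟩
  have hu : 0 ≤ u := by linarith
  simp only [bump_empty, intervalIntegral.integral_zero, sub_zero, zero_add,
    insert_empty_eq] at hi
  rw [hi]
  rcases hu.eq_or_lt with rfl | hu
  · simp only [add_zero, intervalIntegral.integral_same]
    positivity
  -- a second segment of length `0` in the same direction turns this into a special case
  have h := integral_two_segments ρ A a he he (c := 0) (x := x) (y := 0) (u := u) (v := 0)
    (by rw [real_inner_self_eq_norm_sq, he]; norm_num) (by linarith)
  rw [segCost_eq (by linarith)] at h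
  have h2 := sub_cube_le hρ one_pos hu.le
  simp only [add_zero, intervalIntegral.integral_same, mul_zero, zero_div, zero_mul, one_pow,
    mul_one] at h h2
  rw [h]
  have : 0 ≤ u * ‖A - a + ((u * (x + u / 2) / u) • e + (0 : ℝ) • e)‖ ^ 2 := by positivity
  linarith

lemma exists_bump_eq {E : Type*} [NormedAddCommGroup E] (ρ : ℝ) {T : Finset E}
    (hT : T.Nonempty) (x : E) : ∃ a ∈ T, bump ρ T x = bump ρ {a} x := by
  obtain ⟨a, ha, h⟩ := Finset.exists_mem_eq_sup T hT fun a => (ρ ^ 2 - ‖x - a‖ ^ 2).toNNReal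
  exact ⟨a, ha, by rw [bump, h, bump, Finset.sup_singleton]⟩

namespace Radii

variable {m k : ℕ} {κ r ρ : ℝ} [NeZero m]

lemma sideSum_bump_singleton_le (h : Radii m k κ r ρ) {a : Plane} {z : ZMod m}
    (hz : ∀ w s, 0 ≤ s → s ≤ 2 * Real.sin (Real.pi / m) → ‖side m w s - a‖ < ρ →
      w = z ∨ w = z - 1) :
    sideSum m (bump ρ {a}) ≤ cornerMass ρ (2 * Real.sin (Real.pi / m)) (vert m z) (sideDir m z)
      (-(sideDir m (z - 1))) {a} := by
  refine (h.sideSum_bump_le_sum {a} (fun _ => z) fun b hb => ?_).trans (le_of_eq ?_)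
  · rw [Finset.mem_singleton.1 hb]; exact hz
  · rw [Finset.sum_eq_single z]
    · simp
    · intro w _ hw
      simp [hw.symm, cornerMass, bump_empty]
    · simp

lemma sideSum_bump_corner_le (h : Radii m k κ r ρ) (z : ZMod m) :
    sideSum m (bump ρ {corner m r z}) ≤ 4 / 3 * ρ ^ 3 * (1 / κ) := by
  refine (h.sideSum_bump_singleton_le (z := z) fun w s hs hs' hlt => ?_).trans ?_
  · by_contra hcon
    push Not at hcon
    linarith [h.lt_norm_side_sub_corner hcon.1 hcon.2 hs hs']
  · simpa using (h.cornerMass_vert z {corner m r z}).1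

/-- A centre on a side, not close to one end of this side, captures at most `4/3 ρ³`. -/
lemma sideSum_bump_side_le (h : Radii m k κ r ρ) {a : Plane} {z : ZMod m}
    (hz : ∀ w s, 0 ≤ s → s ≤ 2 * Real.sin (Real.pi / m) → ‖side m w s - a‖ < ρ →
      w = z ∨ w = z - 1) {t : ℝ} (ht : r + ρ ≤ t)
    (ha : a = side m z t ∨ a = side m (z - 1) (2 * Real.sin (Real.pi / m) - t)) :
    sideSum m (bump ρ {a}) ≤ 4 / 3 * ρ ^ 3 := by
  have hL : 0 ≤ 2 * Real.sin (Real.pi / m) := by linarith [h.sin_pos]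
  refine (h.sideSum_bump_singleton_le hz).trans ?_
  rw [cornerMass]
  have i1 := integral_bump_singleton_le h.ρ_pos hL (vert m z) a (norm_sideDir z)
  have i2 := integral_bump_singleton_le h.ρ_pos hL (vert m z) a
    (e := -(sideDir m (z - 1))) (by rw [norm_neg, norm_sideDir])
  rcases ha with ha | ha
  · have : ∫ s in 0..2 * Real.sin (Real.pi / m),
        bump ρ {a} (vert m z + s • -(sideDir m (z - 1))) =
        ∫ s in 0..2 * Real.sin (Real.pi / m), (0 : ℝ) := by
      refine integral_congr_Ioo hL (continuous_bump_ray _ _ _ _) continuous_const fun s hs => ?_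
      rw [← side_pred]
      refine bump_eq_zero h.ρ_pos.le fun b hb => ?_
      rw [Finset.mem_singleton.1 hb, ha, norm_sub_rev]
      exact (h.lt_norm_side_pred z ht (by linarith [hs.1])).le
    rw [this, intervalIntegral.integral_zero]
    linarith
  · have : ∫ s in 0..2 * Real.sin (Real.pi / m), bump ρ {a} (vert m z + s • sideDir m z) =
        ∫ s in 0..2 * Real.sin (Real.pi / m), (0 : ℝ) := by
      refine integral_congr_Ioo hL (continuous_bump_ray _ _ _ _) continuous_const fun s hs => ?_
      refine bump_eq_zero h.ρ_pos.le fun b hb => ?_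
      rw [Finset.mem_singleton.1 hb, ha, norm_sub_rev]
      have := h.lt_norm_side_succ (z - 1) (s := 2 * Real.sin (Real.pi / m) - t) (by linarith)
        hs.1.le
      rw [sub_add_cancel] at this
      exact this.le
    rw [this, intervalIntegral.integral_zero]
    linarith

/-- In a set of centres that captures the maximal mass, the discs of radius `ρ` about two centres
do not overlap on the polygon: the masses captured by the single centres add up to no more than
the maximum. -/
lemma not_overlap (h : Radii m k κ r ρ) {α : Finset Plane}
    (hmax : sideSum m (bump ρ α) = 4 / 3 * ρ ^ 3 * (α.card + m * (1 / κ - 1)))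
    {a b : Plane} (ha : a ∈ α) (hb : b ∈ α) (hab : a ≠ b) {z : ZMod m} {s : ℝ} (hs : 0 ≤ s)
    (hs' : s ≤ 2 * Real.sin (Real.pi / m)) (hza : ‖side m z s - a‖ < ρ) :
    ρ ≤ ‖side m z s - b‖ := by
  classical
  by_contra hzb
  push Not at hzb
  set C : Finset Plane := Finset.univ.image (corner m r) with hC
  have hM : 0 < 4 / 3 * ρ ^ 3 := by have := h.ρ_pos; positivity
  have hone : ∀ c ∈ α, sideSum m (bump ρ {c}) ≤
      4 / 3 * ρ ^ 3 * (1 + if c ∈ C then (1 / κ - 1) else 0) := by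
    intro c hc
    obtain ⟨w, hw, hpos⟩ := ((h.sideSum_bump_le α).2 hmax).2 c hc
    by_cases hcC : c ∈ C
    · obtain ⟨w, -, rfl⟩ := Finset.mem_image.1 hcC
      rw [if_pos hcC]
      have := h.sideSum_bump_corner_le w
      linarith
    · rw [if_neg hcC]
      rcases hpos with rfl | ⟨t, ht, -, hc'⟩
      · exact absurd (Finset.mem_image_of_mem _ (Finset.mem_univ w)) hcC
      · have := h.sideSum_bump_side_le hw ht hc'
        linarith
  have hle : ∀ x, bump ρ α x ≤ ∑ c ∈ α, bump ρ {c} x := by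
    intro x
    obtain ⟨c, hc, hcx⟩ := exists_bump_eq ρ ⟨a, ha⟩ x
    rw [hcx]
    exact Finset.single_le_sum (f := fun c => bump ρ {c} x) (fun _ _ => bump_nonneg _ _ _) hc
  have hlt : bump ρ α (side m z s) < ∑ c ∈ α, bump ρ {c} (side m z s) := by
    obtain ⟨c, hc, hcx⟩ := exists_bump_eq ρ ⟨a, ha⟩ (side m z s)
    obtain ⟨d, hd, hdc, hdz⟩ : ∃ d ∈ α, d ≠ c ∧ ‖side m z s - d‖ < ρ := by
      by_cases hac : a = c
      · exact ⟨b, hb, fun hbc => hab (hac.trans hbc.symm), hzb⟩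
      · exact ⟨a, ha, hac, hza⟩
    rw [hcx]
    exact Finset.single_lt_sum (f := fun c => bump ρ {c} (side m z s)) hdc hc hd (bump_pos (Finset.mem_singleton_self d) hdz)
      fun _ _ _ => bump_nonneg _ _ _
  have hcont : Continuous fun x => ∑ c ∈ α, bump ρ {c} x :=
    continuous_finsetSum α fun c _ => continuous_bump ρ {c}
  have hsum : sideSum m (bump ρ α) < sideSum m (fun x => ∑ c ∈ α, bump ρ {c} x) :=
    sideSum_lt h.three_le (continuous_bump ρ α) hcont (fun _ _ _ _ => hle _) hs hs' hlt
  have hexp : sideSum m (fun x => ∑ c ∈ α, bump ρ {c} x) = ∑ c ∈ α, sideSum m (bump ρ {c}) :=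
    sideSum_finset_sum (f := fun c => bump ρ {c}) α fun c => continuous_bump ρ {c}
  rw [hexp] at hsum
  have hbound : ∑ c ∈ α, sideSum m (bump ρ {c}) ≤
      4 / 3 * ρ ^ 3 * (α.card + (α ∩ C).card * (1 / κ - 1)) := by
    refine (Finset.sum_le_sum hone).trans (le_of_eq ?_)
    rw [← Finset.mul_sum, Finset.sum_add_distrib, Finset.sum_ite_mem, Finset.sum_const,
      Finset.sum_const, nsmul_eq_mul, nsmul_eq_mul, mul_one]
  have hCm : ((α ∩ C).card : ℝ) ≤ m := by
    have h1 : (α ∩ C).card ≤ C.card := Finset.card_le_card Finset.inter_subset_right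
    have h2 : C.card ≤ m := Finset.card_image_le.trans (by simp [ZMod.card])
    exact_mod_cast h1.trans h2
  have h3 : ((α ∩ C).card : ℝ) * (1 / κ - 1) ≤ m * (1 / κ - 1) :=
    mul_le_mul_of_nonneg_right hCm (by linarith [h.one_lt_inv])
  have h4 := mul_le_mul_of_nonneg_left
    (add_le_add_right h3 (α.card : ℝ)) hM.le
  linarith

/-- A centre of a maximal configuration that lies on a side keeps the distance `r + ρ` from the
ends of this side, as the segments of length `r` there belong to the corner centres. -/
lemma mem_Icc_of_maximal (h : Radii m k κ r ρ) {α : Finset Plane}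
    (hmax : sideSum m (bump ρ α) = 4 / 3 * ρ ^ 3 * (α.card + m * (1 / κ - 1)))
    {z : ZMod m} {t : ℝ} (ha : side m z t ∈ α) (ht : ρ ≤ t)
    (ht' : t ≤ 2 * Real.sin (Real.pi / m) - ρ) (h0 : side m z t ≠ corner m r z)
    (h1 : side m z t ≠ corner m r (z + 1)) :
    r + ρ ≤ t ∧ t ≤ 2 * Real.sin (Real.pi / m) - (r + ρ) := by
  have hc := ((h.sideSum_bump_le α).2 hmax).1
  have hρ := h.ρ_pos
  have hr := h.r_pos
  constructor
  · by_contra hcon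
    push Not at hcon
    obtain ⟨s, hs1, hs2⟩ := exists_between (show t - ρ < min r (t + ρ) from
      lt_min (by linarith) (by linarith))
    obtain ⟨hs3, hs4⟩ := lt_min_iff.1 hs2
    have k1 : ‖side m z s - side m z t‖ < ρ := by
      rw [norm_side_sub_side, abs_lt]; constructor <;> linarith
    have k2 := h.not_overlap hmax ha (hc z) h0 (by linarith) (by linarith) k1
    linarith [(h.norm_side_sub_corner_lt_iff z (by linarith : 0 ≤ s)).2 hs3]
  · by_contra hcon
    push Not at hcon
    obtain ⟨s, hs2, hs1⟩ := exists_between (show max (2 * Real.sin (Real.pi / m) - r) (t - ρ) <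
      t + ρ from max_lt (by linarith) (by linarith))
    obtain ⟨hs3, hs4⟩ := max_lt_iff.1 hs2
    have k1 : ‖side m z s - side m z t‖ < ρ := by
      rw [norm_side_sub_side, abs_lt]; constructor <;> linarith
    have k2 := h.not_overlap hmax ha (hc (z + 1)) h1 (by linarith) (by linarith) k1
    have k3 := (h.norm_side_pred_sub_corner_lt_iff (z + 1) (s := s) (by linarith)).2 hs3
    rw [add_sub_cancel_right] at k3
    linarith

lemma eq_corner_or_eq_side (h : Radii m k κ r ρ) {α : Finset Plane}
    (hmax : sideSum m (bump ρ α) = 4 / 3 * ρ ^ 3 * (α.card + m * (1 / κ - 1)))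
    {a : Plane} (ha : a ∈ α) : (∃ z : ZMod m, a = corner m r z) ∨ ∃ (z : ZMod m) (t : ℝ),
      r + ρ ≤ t ∧ t ≤ 2 * Real.sin (Real.pi / m) - (r + ρ) ∧ a = side m z t := by
  rw [or_iff_not_imp_left]
  intro hne
  push Not at hne
  have hr := h.r_pos
  obtain ⟨z, -, hpos⟩ := ((h.sideSum_bump_le α).2 hmax).2 a ha
  rcases hpos.resolve_left (hne z) with ⟨t, ht, ht', rfl | rfl⟩
  · have := h.mem_Icc_of_maximal hmax ha (by linarith) ht' (hne _) (hne _)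
    exact ⟨z, t, this.1, this.2, rfl⟩
  · have := h.mem_Icc_of_maximal hmax ha (by linarith) (by linarith) (hne _) (hne _)
    exact ⟨z - 1, _, this.1, this.2, rfl⟩

/-- The segments captured by the centres on a side neither overlap nor leave gaps, so that the
positions of the centres are determined one after the other. -/
lemma side_mem_of_maximal (h : Radii m k κ r ρ) {α : Finset Plane}
    (hmax : sideSum m (bump ρ α) = 4 / 3 * ρ ^ 3 * (α.card + m * (1 / κ - 1)))
    (hcov : ∀ z : ZMod m, ∀ s, 0 ≤ s → s ≤ 2 * Real.sin (Real.pi / m) →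
      ∃ a ∈ α, ‖side m z s - a‖ ≤ ρ) (z : ZMod m) (i : ℕ) (hi : i < k - 1) :
    side m z (r + (2 * i + 1) * ρ) ∈ α := by
  have hρ := h.ρ_pos
  have hr := h.r_pos
  have hend : ∀ i : ℕ, i < k - 1 →
      r + (2 * i + 1) * ρ ≤ 2 * Real.sin (Real.pi / m) - r - ρ := by
    intro i hi
    rw [← h.add_eq_length]
    have : ((i + 1 : ℕ) : ℝ) ≤ (k - 1 : ℕ) := by exact_mod_cast hi
    push_cast at this
    nlinarith
  by_contra hcon
  -- a centre captures the points just behind the segments of the previous centres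
  obtain ⟨ε, hε, hball⟩ := Metric.isOpen_iff.1 α.finite_toSet.isClosed.isOpen_compl
    (side m z (r + (2 * i + 1) * ρ)) (by simpa using hcon)
  set δ := min (ε / 2) ρ with hδ
  have hδ0 : 0 < δ := lt_min (by linarith) hρ
  have hδ1 : δ ≤ ε / 2 := min_le_left _ _
  have hδ2 : δ ≤ ρ := min_le_right _ _
  have hie := hend i hi
  have hi0 : 0 ≤ 2 * (i : ℝ) * ρ := by positivity
  set x := r + 2 * i * ρ + δ with hx
  have hx0 : 0 ≤ x := by linarith
  have hx1 : x ≤ 2 * Real.sin (Real.pi / m) - r - ρ + δ - ρ := by linarith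
  obtain ⟨a, ha, hax⟩ := hcov z x hx0 (by linarith)
  obtain ⟨t, ht, ht', rfl⟩ : ∃ t, r + ρ ≤ t ∧ t ≤ 2 * Real.sin (Real.pi / m) - (r + ρ) ∧
      a = side m z t := by
    rcases h.eq_corner_or_eq_side hmax ha with ⟨w, rfl⟩ | ⟨w, t, ht, ht', rfl⟩
    · exfalso
      by_cases hw : z = w
      · rw [← hw, h.norm_side_sub_corner_le_iff z hx0] at hax
        linarith
      by_cases hw' : z = w - 1
      · rw [hw', h.norm_side_pred_sub_corner_le_iff w (by linarith)] at hax
        linarith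
      linarith [h.lt_norm_side_sub_corner hw hw' hx0 (by linarith)]
    · by_cases hw : z = w
      · exact ⟨t, ht, ht', by rw [hw]⟩
      · linarith [h.lt_norm_side hw ht ht' hx0 (by linarith)]
  rw [norm_side_sub_side, abs_le] at hax
  have hlow : r + (2 * i + 1) * ρ ≤ t := by
    rcases Nat.eq_zero_or_pos i with hi' | hi'
    · rw [hi']; simpa using ht
    · obtain ⟨j, rfl⟩ : ∃ j, i = j + 1 := ⟨i - 1, by omega⟩
      have hprev := side_mem_of_maximal h hmax hcov z j (by omega)
      have hje := hend j (by omega)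
      push_cast at hx ⊢
      have hj0 : 0 ≤ 2 * (j : ℝ) * ρ := by positivity
      set t' := r + (2 * (j : ℝ) + 1) * ρ with ht'
      have htt : t' < t := by linarith
      by_contra hlt
      have k1 : ‖side m z ((t' + t) / 2) - side m z t'‖ < ρ := by
        rw [norm_side_sub_side, abs_lt]; constructor <;> linarith
      have k2 : ‖side m z ((t' + t) / 2) - side m z t‖ < ρ := by
        rw [norm_side_sub_side, abs_lt]; constructor <;> linarith
      have hne : side m z t' ≠ side m z t := by
        intro he
        have h0 := norm_side_sub_side z t' t
        rw [he, sub_self, norm_zero] at h0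
        linarith [abs_eq_zero.1 h0.symm]
      linarith [h.not_overlap hmax hprev ha hne (by linarith) (by linarith) k1]
  have hmem : side m z t ∈ Metric.ball (side m z (r + (2 * i + 1) * ρ)) ε := by
    rw [Metric.mem_ball, dist_eq_norm, norm_side_sub_side, abs_lt]
    constructor <;> linarith
  exact hball hmem ha
termination_by i

/-- The set `polyMeans m k r` is the only set of at most `m k` centres with distortion `ρ² / 3`. -/
lemma eq_polyMeans (h : Radii m k κ r ρ) {α : Finset Plane} (hα : α.Nonempty)
    (hcard : α.card ≤ m * k) (hd : distortion (polyUniform m) α = ρ ^ 2 / 3) :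
    α = polyMeans m k r := by
  obtain ⟨-, hmax, hcov⟩ := (h.le_distortion hα hcard).2 hd
  refine (Finset.eq_of_subset_of_card_le (fun a ha => ?_) ?_).symm
  · rcases h.mem_polyMeans.1 ha with ⟨z, rfl⟩ | ⟨z, i, hi, rfl⟩
    · exact ((h.sideSum_bump_le α).2 hmax).1 z
    · exact h.side_mem_of_maximal hmax hcov z i hi
  · rwa [h.card_polyMeans]

lemma isOptimalSetOfMeans_iff (h : Radii m k κ r ρ) (α : Finset Plane) :
    IsOptimalSetOfMeans (polyUniform m) (m * k) α ↔ α = polyMeans m k r := by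
  rw [IsOptimalSetOfMeans, h.quantizationError_eq]
  constructor
  · rintro ⟨h1, h2, h3⟩
    exact h.eq_polyMeans (Finset.card_pos.1 h1) h2 h3
  · rintro rfl
    exact ⟨h.polyMeans_nonempty.card_pos, h.card_polyMeans_le, h.distortion_polyMeans⟩

end Radii

end Uniqueness

/-! ### The Voronoi regions of the corner centres -/

section Voronoi

/-- A point of a finite set that is strictly closest to `x` has `x` in the interior of its Voronoi
region. -/
lemma mem_interior_voronoiRegion {α : Finset Plane} {a x : Plane}
    (h : ∀ b ∈ α, b ≠ a → dist x a < dist x b) : x ∈ interior (voronoiRegion α a) := by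
  classical
  rw [mem_interior]
  refine ⟨⋂ b ∈ α.erase a, {y | dist y a < dist y b}, fun y hy b hb => ?_, ?_, ?_⟩
  · by_cases hba : b = a
    · rw [hba]
    · exact (Set.mem_iInter₂.1 hy b (Finset.mem_erase.2 ⟨hba, hb⟩) :
        y ∈ {y | dist y a < dist y b}).le
  · exact isOpen_biInter_finset fun b _ => isOpen_lt (by fun_prop) (by fun_prop)
  · exact Set.mem_iInter₂.2 fun b hb => h b (Finset.mem_of_mem_erase hb) (Finset.ne_of_mem_erase hb)

lemma isClosed_voronoiRegion (α : Finset Plane) (a : Plane) :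
    IsClosed (voronoiRegion α a) := by
  have : voronoiRegion α a = ⋂ b ∈ α, {x | dist x a ≤ dist x b} := by
    ext x; simp [voronoiRegion]
  rw [this]
  exact isClosed_biInter fun b _ => isClosed_le (by fun_prop) (by fun_prop)

/-- If `x` is as close to another point `b` as to `a`, then moving from `x` away from `a` and
towards `b` leaves the Voronoi region of `a` at once. -/
lemma notMem_interior_voronoiRegion {α : Finset Plane} {a b x : Plane} (hb : b ∈ α)
    (hab : b ≠ a) (h : dist x b = dist x a) : x ∉ interior (voronoiRegion α a) := by
  intro hx
  have hcont : Filter.Tendsto (fun t : ℝ => x + t • (b - a)) (nhdsWithin 0 (Set.Ioi 0))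
      (nhds x) := by
    have : Continuous fun t : ℝ => x + t • (b - a) := by fun_prop
    have h2 := (this.tendsto 0).mono_left (nhdsWithin_le_nhds (s := Set.Ioi (0 : ℝ)))
    simpa using h2
  obtain ⟨t, ht, ht0⟩ := ((hcont.eventually (mem_interior_iff_mem_nhds.1 hx)).and
    self_mem_nhdsWithin).exists
  have ht1 := ht b hb
  rw [dist_eq_norm, dist_eq_norm] at ht1 h
  have ht2 := pow_le_pow_left₀ (norm_nonneg _) ht1 2
  have e1 : x + t • (b - a) - a = (x - a) + t • (b - a) := by abel
  have e2 : x + t • (b - a) - b = (x - b) + t • (b - a) := by abel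
  rw [e1, e2, norm_add_sq_real, norm_add_sq_real, h, inner_smul_right, inner_smul_right] at ht2
  have e3 : inner ℝ (x - a) (b - a) - inner ℝ (x - b) (b - a) = ‖b - a‖ ^ 2 := by
    rw [← inner_sub_left, sub_sub_sub_cancel_left, real_inner_self_eq_norm_sq]
  have h3 : 0 < ‖b - a‖ := norm_pos_iff.2 (sub_ne_zero.2 hab)
  have h4 : 0 < t * ‖b - a‖ ^ 2 := mul_pos ht0 (by positivity)
  rw [← e3] at h4
  linarith

namespace Radii

variable {m k : ℕ} {κ r ρ : ℝ}

lemma dist_vert_side (z : ZMod m) {s : ℝ} (hs : 0 ≤ s) : dist (vert m z) (side m z s) = s := by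
  rw [dist_eq_norm, side, sub_add_cancel_left, norm_neg, norm_smul, norm_sideDir, mul_one,
    Real.norm_eq_abs, abs_of_nonneg hs]

variable [NeZero m]

/-- Every point of the polygon is within distance `ρ` of a centre. -/
lemma exists_norm_le (h : Radii m k κ r ρ) (z : ZMod m) {s : ℝ} (hs : 0 ≤ s)
    (hs' : s ≤ 2 * Real.sin (Real.pi / m)) : ∃ a ∈ polyMeans m k r, ‖side m z s - a‖ ≤ ρ :=
  ((h.le_distortion h.polyMeans_nonempty h.card_polyMeans_le).2 h.distortion_polyMeans).2.2
    z s hs hs'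

/-- The discs of radius `ρ` about two centres do not overlap on the polygon. -/
lemma le_norm_of_norm_lt (h : Radii m k κ r ρ) {a b : Plane} (ha : a ∈ polyMeans m k r)
    (hb : b ∈ polyMeans m k r) (hab : a ≠ b) {z : ZMod m} {s : ℝ} (hs : 0 ≤ s)
    (hs' : s ≤ 2 * Real.sin (Real.pi / m)) (hza : ‖side m z s - a‖ < ρ) :
    ρ ≤ ‖side m z s - b‖ :=
  h.not_overlap ((h.le_distortion h.polyMeans_nonempty h.card_polyMeans_le).2
    h.distortion_polyMeans).2.1 ha hb hab hs hs' hza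

lemma first_side_mem (h : Radii m k κ r ρ) (z : ZMod m) :
    side m z (r + ρ) ∈ polyMeans m k r :=
  h.mem_polyMeans.2 (Or.inr ⟨z, 0, by have := h.two_le; omega, by simp⟩)

lemma last_side_mem (h : Radii m k κ r ρ) (z : ZMod m) :
    side m z (2 * Real.sin (Real.pi / m) - (r + ρ)) ∈ polyMeans m k r := by
  refine h.mem_polyMeans.2 (Or.inr ⟨z, k - 2, by have := h.two_le; omega, ?_⟩)
  have e := h.length_eq
  rw [Nat.cast_sub h.two_le]
  congr 1
  push_cast
  linear_combination e

/-- A point at distance exactly `ρ` from two centres `a` and `b` lies on the frontier of the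
Voronoi region of `a` if it is a limit of points of the polygon closer than `ρ` to `a`: the latter
excludes a third centre closer to the point. -/
lemma mem_frontier (h : Radii m k κ r ρ) {a b : Plane} (ha : a ∈ polyMeans m k r)
    (hb : b ∈ polyMeans m k r) (hab : b ≠ a) {z : ZMod m} {s : ℝ}
    (hza : ‖side m z s - a‖ = ρ) (hzb : ‖side m z s - b‖ = ρ)
    (hlim : ∀ ε > 0, ∃ t, |t - s| < ε ∧ 0 ≤ t ∧ t ≤ 2 * Real.sin (Real.pi / m) ∧
      ‖side m z t - a‖ < ρ) :
    side m z s ∈ frontier (voronoiRegion (polyMeans m k r) a) := by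
  rw [(isClosed_voronoiRegion _ _).frontier_eq]
  refine ⟨fun c hc => ?_, notMem_interior_voronoiRegion hb hab ?_⟩
  · rw [dist_eq_norm, dist_eq_norm, hza]
    by_contra hcon
    push Not at hcon
    obtain ⟨t, ht, ht0, ht1, hta⟩ := hlim (ρ - ‖side m z s - c‖) (by linarith)
    have hac : a ≠ c := by
      rintro rfl
      linarith
    have h1 := h.le_norm_of_norm_lt ha hc hac ht0 ht1 hta
    have h2 := norm_sub_le_norm_sub_add_norm_sub (side m z t) (side m z s) c
    rw [norm_side_sub_side] at h2
    linarith
  · rw [dist_eq_norm, dist_eq_norm, hza, hzb]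

lemma mem_polyBoundary (h : Radii m k κ r ρ) {x : Plane} : x ∈ polyBoundary m ↔
    ∃ (z : ZMod m) (s : ℝ), 0 ≤ s ∧ s ≤ 2 * Real.sin (Real.pi / m) ∧ x = side m z s := by
  have hL : 0 < 2 * Real.sin (Real.pi / m) := by linarith [h.sin_pos]
  simp only [polyBoundary, Set.mem_iUnion, Set.mem_image, polySide_eq, exists_prop]
  constructor
  · rintro ⟨j, -, t, ⟨ht, ht'⟩, rfl⟩
    exact ⟨j, _, mul_nonneg ht hL.le, mul_le_of_le_one_left hL.le ht', rfl⟩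
  · rintro ⟨z, s, hs, hs', rfl⟩
    obtain ⟨j, hj, rfl⟩ := exists_natCast_eq z
    exact ⟨j, hj, s / (2 * Real.sin (Real.pi / m)), ⟨by positivity, (div_le_one hL).2 hs'⟩,
      by rw [div_mul_cancel₀ _ hL.ne']⟩

lemma frontier_inter_polyBoundary (h : Radii m k κ r ρ) (z : ZMod m) :
    frontier (voronoiRegion (polyMeans m k r) (corner m r z)) ∩ polyBoundary m =
      {side m (z - 1) (2 * Real.sin (Real.pi / m) - r), side m z r} := by
  have hr := h.r_pos
  have hρ := h.ρ_pos
  have hrs := h.add_le_sin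
  have hc := h.corner_mem_polyMeans z
  ext x
  simp only [Set.mem_inter_iff, Set.mem_insert_iff, Set.mem_singleton_iff, h.mem_polyBoundary]
  constructor
  · rintro ⟨hx, w, s, hs, hs', rfl⟩
    rw [(isClosed_voronoiRegion _ _).frontier_eq] at hx
    obtain ⟨hxV, hxI⟩ := hx
    obtain ⟨a, ha, hxa⟩ := h.exists_norm_le w hs hs'
    have h1 := hxV a ha
    rw [dist_eq_norm, dist_eq_norm] at h1
    have hle := h1.trans hxa
    have hge : ¬ ‖side m w s - corner m r z‖ < ρ := fun hlt =>
      hxI (mem_interior_voronoiRegion fun b hb hba => by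
        rw [dist_eq_norm, dist_eq_norm]
        exact hlt.trans_le (h.le_norm_of_norm_lt hc hb hba.symm hs hs' hlt))
    by_cases hw : w = z
    · subst hw
      rw [h.norm_side_sub_corner_lt_iff w hs] at hge
      rw [h.norm_side_sub_corner_le_iff w hs] at hle
      right
      rw [le_antisymm hle (not_lt.1 hge)]
    by_cases hw' : w = z - 1
    · subst hw'
      rw [h.norm_side_pred_sub_corner_lt_iff z hs'] at hge
      rw [h.norm_side_pred_sub_corner_le_iff z hs'] at hle
      left
      rw [le_antisymm (not_lt.1 hge) hle]
    linarith [h.lt_norm_side_sub_corner hw hw' hs hs']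
  · rintro (rfl | rfl)
    · refine ⟨h.mem_frontier hc (h.last_side_mem (z - 1)) ?_ ?_ ?_ ?_,
        z - 1, _, by linarith, by linarith, rfl⟩
      · intro he
        have h1 := h.norm_side_pred_sub_corner_le_iff z
          (s := 2 * Real.sin (Real.pi / m) - (r + ρ)) (by linarith)
        rw [he, sub_self, norm_zero] at h1
        linarith [h1.1 hρ.le]
      · refine le_antisymm ((h.norm_side_pred_sub_corner_le_iff z (by linarith)).2 le_rfl) ?_
        exact not_lt.1 fun hlt => lt_irrefl _
          ((h.norm_side_pred_sub_corner_lt_iff z (by linarith)).1 hlt)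
      · rw [norm_side_sub_side, abs_of_pos (by linarith)]
        ring
      · intro ε hε
        have h1 : 0 < min (ε / 2) r := lt_min (by linarith) hr
        have h2 := min_le_left (ε / 2) r
        have h3 := min_le_right (ε / 2) r
        refine ⟨2 * Real.sin (Real.pi / m) - r + min (ε / 2) r, ?_, by linarith, by linarith,
          (h.norm_side_pred_sub_corner_lt_iff z (by linarith)).2 (by linarith)⟩
        rw [add_sub_cancel_left, abs_of_pos h1]
        linarith
    · refine ⟨h.mem_frontier hc (h.first_side_mem z) ?_ ?_ ?_ ?_,
        z, _, by linarith, by linarith, rfl⟩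
      · intro he
        have h1 := h.norm_side_sub_corner_le_iff z (s := r + ρ) (by linarith)
        rw [he, sub_self, norm_zero] at h1
        linarith [h1.1 hρ.le]
      · refine le_antisymm ((h.norm_side_sub_corner_le_iff z hr.le).2 le_rfl) ?_
        exact not_lt.1 fun hlt => lt_irrefl _ ((h.norm_side_sub_corner_lt_iff z hr.le).1 hlt)
      · rw [norm_side_sub_side, abs_sub_comm, abs_of_pos (by linarith)]
        ring
      · intro ε hε
        have h1 : 0 < min (ε / 2) r := lt_min (by linarith) hr
        have h2 := min_le_left (ε / 2) r
        have h3 := min_le_right (ε / 2) r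
        refine ⟨r - min (ε / 2) r, ?_, by linarith, by linarith,
          (h.norm_side_sub_corner_lt_iff z (by linarith)).2 (by linarith)⟩
        rw [sub_sub_cancel_left, abs_neg, abs_of_pos h1]
        linarith

lemma corner_mem_polyAngleInterior (h : Radii m k κ r ρ) {j : ℕ} (hj : 1 ≤ j) :
    corner m r (j : ZMod m) ∈ polyAngleInterior m j := by
  have hs := h.sin_pos
  have hu : 0 < r / (4 * (2 * Real.sin (Real.pi / m))) := by have := h.r_pos; positivity
  refine ⟨_, _, hu, hu, ?_⟩
  have e1 : polyVertex m (j + 1) - polyVertex m j =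
      (2 * Real.sin (Real.pi / m)) • sideDir m (j : ZMod m) := by
    rw [← vert_natCast, ← vert_natCast, Nat.cast_add, Nat.cast_one, vert_succ_eq]
    abel
  have e2 : polyVertex m (j - 1) - polyVertex m j =
      (2 * Real.sin (Real.pi / m)) • -(sideDir m ((j : ZMod m) - 1)) := by
    have h1 := vert_succ_eq ((j : ZMod m) - 1)
    rw [sub_add_cancel] at h1
    rw [← vert_natCast, ← vert_natCast, Nat.cast_sub hj, Nat.cast_one, h1]
    module
  have e3 : r / (4 * (2 * Real.sin (Real.pi / m))) * (2 * Real.sin (Real.pi / m)) = r / 4 := by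
    field_simp
  rw [corner, vert_natCast, e1, e2, smul_smul, smul_smul, e3, smul_add, add_assoc]

lemma dist_vert_side_pred (z : ZMod m) {s : ℝ} (hs : 0 ≤ s) :
    dist (vert m z) (side m (z - 1) (2 * Real.sin (Real.pi / m) - s)) = s := by
  rw [dist_eq_norm, side_pred, sub_add_cancel_left, norm_neg, norm_smul, norm_neg, norm_sideDir,
    mul_one, Real.norm_eq_abs, abs_of_nonneg hs]

end Radii

end Voronoi

/-! ### The numbers `r` and `V_n` -/

/-- The number `r` of the theorem, with the corresponding numbers `κ` and `ρ`. -/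
lemma exists_radii {m k : ℕ} (hm : 3 ≤ m) (hk : 2 ≤ k) {r : ℝ}
    (hr : r = 4 * Real.sin (Real.pi / m) /
      (2 * ((k : ℝ) - 1) * Real.sqrt (3 * Real.cos (Real.pi / m) ^ 2 + 1) + 4)) :
    ∃ κ ρ, Radii m k κ r ρ := by
  have hs := sin_pos_of_three_le hm
  have hk' : (0 : ℝ) < k - 1 := by
    have : (2 : ℝ) ≤ k := by exact_mod_cast hk
    linarith
  have h1 : 0 < Real.sqrt (3 * Real.cos (Real.pi / m) ^ 2 + 1) := Real.sqrt_pos.2 (by positivity)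
  refine ⟨Real.sqrt (3 * Real.cos (Real.pi / m) ^ 2 + 1) / 2, _, hm, hk, by positivity, ?_, ?_,
    rfl, ?_⟩
  · rw [div_pow, Real.sq_sqrt (by positivity)]
    norm_num
  · rw [hr]; positivity
  · have h2 : 2 * ((k : ℝ) - 1) * Real.sqrt (3 * Real.cos (Real.pi / m) ^ 2 + 1) + 4 ≠ 0 := by
      positivity
    have h3 := (eq_div_iff h2).1 hr
    linear_combination (-(1 / 2)) * h3

lemma Radii.sq_div_three_eq {m k : ℕ} {κ r ρ : ℝ} (h : Radii m k κ r ρ) :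
    ρ ^ 2 / 3 = 2 * Real.sin (Real.pi / m) ^ 2 * (3 * Real.cos (2 * Real.pi / m) + 5) /
        (3 * (k * Real.sqrt (6 * Real.cos (2 * Real.pi / m) + 10)
          - Real.sqrt (6 * Real.cos (2 * Real.pi / m) + 10) + 4) ^ 2) := by
  have hκ := h.κ_sq
  have hκ0 := h.κ_pos
  have hk := h.sub_one_pos
  have h1 : 3 * Real.cos (2 * Real.pi / m) + 5 = 8 * κ ^ 2 := by
    rw [mul_div_assoc, Real.cos_two_mul, hκ]; ring
  have h2 : Real.sqrt (6 * Real.cos (2 * Real.pi / m) + 10) = 4 * κ := by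
    rw [show 6 * Real.cos (2 * Real.pi / m) + 10 = (4 * κ) ^ 2 by linear_combination 2 * h1]
    exact Real.sqrt_sq (by positivity)
  have h3 : 0 < 1 + κ * (k - 1) := by positivity
  have h4 : Real.sin (Real.pi / m) = r * (1 + κ * (k - 1)) := by
    have := h.length_eq
    rw [h.ρ_eq] at this
    linarith
  have h5 : (k : ℝ) * (4 * κ) - 4 * κ + 4 = 4 * (1 + κ * (k - 1)) := by ring
  rw [h1, h2, h4, h5, h.ρ_eq]
  field_simp
  ring

theorem mainTheorem2 (m k : ℕ) (hm : 3 ≤ m) (hk : 2 ≤ k) (r : ℝ)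
    (hr : r = 4 * Real.sin (Real.pi / m) /
      (2 * ((k : ℝ) - 1) * Real.sqrt (3 * Real.cos (Real.pi / m) ^ 2 + 1) + 4)) :
    -- the explicit set is the one and only optimal set of `mk`-means, and it has `mk` points
    (∀ α : Finset Plane,
      IsOptimalSetOfMeans (polyUniform m) (m * k) α ↔ α = polyMeans m k r) ∧
    (polyMeans m k r).card = m * k ∧
    -- `r` is the cut-off distance: the boundary of the Voronoi region of `a_j`, a point inside
    -- the angle at `A_j`, cuts `L` in exactly two points, one on each of the two sides adjacent
    -- to `A_j`, both at distance `r` from `A_j`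
    (0 < r ∧ r ≤ polySideLength m / 2) ∧
    (∀ j ∈ Finset.Icc 1 m,
      anglePoint m r j ∈ polyAngleInterior m j ∧
      frontier (voronoiRegion (polyMeans m k r) (anglePoint m r j)) ∩ polyBoundary m =
        {polySide m (j - 1) (1 - r / polySideLength m), polySide m j (r / polySideLength m)} ∧
      dist (polyVertex m j) (polySide m (j - 1) (1 - r / polySideLength m)) = r ∧
      dist (polyVertex m j) (polySide m j (r / polySideLength m)) = r) ∧
    -- the quantization error
    quantizationError (polyUniform m) (m * k) =
      2 * Real.sin (Real.pi / m) ^ 2 * (3 * Real.cos (2 * Real.pi / m) + 5) /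
        (3 * (k * Real.sqrt (6 * Real.cos (2 * Real.pi / m) + 10)
          - Real.sqrt (6 * Real.cos (2 * Real.pi / m) + 10) + 4) ^ 2) := by
  have : NeZero m := ⟨by omega⟩
  obtain ⟨κ, ρ, h⟩ := exists_radii hm hk hr
  have hL : 2 * Real.sin (Real.pi / m) ≠ 0 := by linarith [h.sin_pos]
  refine ⟨h.isOptimalSetOfMeans_iff, h.card_polyMeans, ⟨h.r_pos, ?_⟩, fun j hj => ?_, ?_⟩
  · rw [polySideLength_eq hm]
    linarith [h.add_le_sin, h.ρ_pos]
  · have hj1 := (Finset.mem_Icc.1 hj).1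
    have e1 : polySide m (j - 1) (1 - r / polySideLength m) =
        side m ((j : ZMod m) - 1) (2 * Real.sin (Real.pi / m) - r) := by
      rw [polySide_eq, polySideLength_eq hm, Nat.cast_sub hj1, Nat.cast_one, sub_mul, one_mul,
        div_mul_cancel₀ _ hL]
    have e2 : polySide m j (r / polySideLength m) = side m (j : ZMod m) r := by
      rw [polySide_eq, polySideLength_eq hm, div_mul_cancel₀ _ hL]
    rw [e1, e2, anglePoint_eq hm, ← vert_natCast]
    exact ⟨h.corner_mem_polyAngleInterior hj1, h.frontier_inter_polyBoundary j,
      Radii.dist_vert_side_pred _ h.r_pos.le, Radii.dist_vert_side _ h.r_pos.le⟩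
  · rw [h.quantizationError_eq, h.sq_div_three_eq]
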